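/- **Conventions.** For $y\in\mathbb F_2^n$ let $|y|$ be the Hamming weight, and for a linear code $C\subseteq\mathbb F_2^n$ let $|y|_C=\min_{y'\in C}|y+y'|$ and $C^\perp=\{x: x\cdot y=0\ \forall y\in C\}$. A binary CSS code $\mathcal C$ of block length $n$ is given by parity-check matrices $H_X\in\mathbb F_2^{m_X\times n}$, $H_Z\in\mathbb F_2^{m_Z\times n}$ with $C_X=\ker H_X$, $C_Z=\ker H_Z$ and $C_X^\perp\subseteq C_Z$. Its dimension is $k=\dim C_Z-\dim C_X^\perp$ and its distance is $d=\min\{|y|: y\in(C_Z\setminus C_X^\perp)\cup(C_X\setminus C_Z^\perp)\}$; it has locality $\le\ell$ if every row and column of $H_X,H_Z$ has weight $\le\ell$. Its code Hamiltonian is $$\mathbf H=\tfrac12(\mathbf H_X+\mathbf H_Z),\quad \mathbf H_X=\frac1{m_X}\sum_{y\in\mathrm{rows}(H_X)}\frac{I-X^y}{2},\quad \mathbf H_Z=\frac1{m_Z}\sum_{y\in\mathrm{rows}(H_Z)}\frac{I-Z^y}{2}$$ (rows counted with multiplicity, an empty average being $0$), where $X^a|y\rangle=|y+a\rangle$ and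 $Z^a|y\rangle=(-1)^{a\cdot y}|y\rangle$. A (possibly mixed) state $\rho$ is an $\epsilon$-approximate ground state of $\mathbf H$ if $\mathrm{Tr}(\rho\mathbf H)\le\epsilon$. A depth-$t$ quantum circuit consists of $t$ layers, each a product of arbitrary unitary gates acting on pairwise disjoint sets of at most two qubits; it constructs an $n$-qubit state $\rho$ if, run on $|0\rangle^{\otimes(n+a)}$ for some $a\ge0$, it yields $\rho$ after tracing out $a$ qubits. For $c_1,c_2,\epsilon_0>0$, the code $\mathcal C$ exhibits $(c_1,c_2,\epsilon_0)$-clustering if for all $0<\epsilon<\epsilon_0$: every $y$ with $|H_Xy|\le\epsilon m_X$ satisfies $|y|_{C_Z^\perp}\le c_1\epsilon n$ or $|y|_{C_Z^\perp}\ge c_2n$, and every $y$ with $|H_Zy|\le\epsilon m_Z$ satisfies $|y|_{C_X^\perp}\le c_1\epsilon n$ or $|y|_{C_X^\perp}\ge c_2n$. For $c_1,c_2>0$, it has $(c_1,c_2)$-small-set boundary expansion if $|H_Zy|/m_Z\ge c_2|y|_{C_X^\perp}/n$ for all $y$ with $|y|\le c_1n$, and $(c_1,c_2)$-small-set coboundary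 expansion if $|H_Xy|/m_X\ge c_2|y|_{C_Z^\perp}/n$ for all such $y$ (with $0/0=0$). **Statement.** 1. Let $\mathcal C$ be a binary CSS code of block length $n$, dimension $k>0$ and distance $d$ that exhibits $(c_1,c_2,\epsilon_0)$-clustering with $c_1,c_2,\epsilon_0>0$, let $\mathbf H$ be its code Hamiltonian, and let $$\epsilon<\frac1{1000}\min\Big\{\frac{\epsilon_0}{2},\ \frac{c_2}{4c_1},\ \frac{d}{2c_1n}\Big\},\qquad \mu=0.02,\qquad \delta=c_2 .$$ Then no $\epsilon$-approximate ground state of $\mathbf H$ can be constructed by a quantum circuit of depth less than $$\frac13\log_2\Big(\frac{\delta^2n}{400\log_2(1/\mu)}\Big)+1 .$$ 2. Let $(\mathcal C_j)_{j\in\mathbb N}$ be a family of binary CSS codes of block lengths $n_j\to\infty$, of locality at most a constant $\ell$, and of positive dimensions, that all have $(c_1,c_2)$-small-set boundary and coboundary expansion for some constants $c_1,c_2>0$. Then the family of their code Hamiltonians $(\mathbf H_j)$ is NLTS: for some constant $\ell'$ every $\mathbf H_j$ is a sum of Hamiltonians each acting nontrivially on at most $\ell'$ qubits, $0\preceq\mathbf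 H_j\preceq I$, and there is $\epsilon>0$ such that the minimum depth of a quantum circuit constructing an $\epsilon$-approximate ground state of $\mathbf H_j$ tends to infinity as $j\to\infty$. -/

import Mathlib

open Filter Topology
open scoped ComplexOrder

noncomputable section

namespace NLTS

/-! ## Binary CSS codes -/

/-- The dual code `C^⊥ = {x : x · y = 0 for all y ∈ C}`. -/
def dualCode {n : ℕ} (C : Submodule (ZMod 2) (Fin n → ZMod 2)) :
    Submodule (ZMod 2) (Fin n → ZMod 2) where
  carrier := {x | ∀ y ∈ C, x ⬝ᵥ y = 0}
  add_mem' := by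
    intro a b ha hb y hy
    rw [add_dotProduct, ha y hy, hb y hy, add_zero]
  zero_mem' := by
    intro y _
    exact zero_dotProduct y
  smul_mem' := by
    intro c x hx y hy
    rw [smul_dotProduct, hx y hy, smul_zero]

/-- `|y|_C = min_{y' ∈ C} |y + y'|`, where `|·|` is the Hamming weight. -/
def cosetWeight {n : ℕ} (C : Submodule (ZMod 2) (Fin n → ZMod 2)) (y : Fin n → ZMod 2) : ℕ :=
  ⨅ y' : C, hammingNorm (y + (y' : Fin n → ZMod 2))

/-- A binary CSS code of block length `n`, given by parity-check matrices `H_X`, `H_Z` with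
`C_X = ker H_X`, `C_Z = ker H_Z` and `C_X^⊥ ⊆ C_Z`. -/
structure CSSCode (n mX mZ : ℕ) where
  HX : Matrix (Fin mX) (Fin n) (ZMod 2)
  HZ : Matrix (Fin mZ) (Fin n) (ZMod 2)
  dual_le : dualCode (LinearMap.ker HX.mulVecLin) ≤ LinearMap.ker HZ.mulVecLin

namespace CSSCode

variable {n mX mZ : ℕ}

/-- `C_X = ker H_X`. -/
def CX (Q : CSSCode n mX mZ) : Submodule (ZMod 2) (Fin n → ZMod 2) :=
  LinearMap.ker Q.HX.mulVecLin

/-- `C_Z = ker H_Z`. -/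
def CZ (Q : CSSCode n mX mZ) : Submodule (ZMod 2) (Fin n → ZMod 2) :=
  LinearMap.ker Q.HZ.mulVecLin

/-- The dimension `k = dim C_Z - dim C_X^⊥`. -/
def dim (Q : CSSCode n mX mZ) : ℕ :=
  Module.finrank (ZMod 2) Q.CZ - Module.finrank (ZMod 2) (dualCode Q.CX)

/-- The distance `d`: the least Hamming weight of an element of
`(C_Z \ C_X^⊥) ∪ (C_X \ C_Z^⊥)`. -/
def dist (Q : CSSCode n mX mZ) : ℕ :=
  sInf {w | ∃ y : Fin n → ZMod 2,
    ((y ∈ Q.CZ ∧ y ∉ dualCode Q.CX) ∨ (y ∈ Q.CX ∧ y ∉ dualCode Q.CZ)) ∧ hammingNorm y = w}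

/-- Locality at most `ℓ`: all rows and all columns of `H_X`, `H_Z` have Hamming weight `≤ ℓ`. -/
def HasLocality (Q : CSSCode n mX mZ) (ℓ : ℕ) : Prop :=
  (∀ i, hammingNorm (Q.HX i) ≤ ℓ) ∧ (∀ j, hammingNorm (fun i => Q.HX i j) ≤ ℓ) ∧
  (∀ i, hammingNorm (Q.HZ i) ≤ ℓ) ∧ (∀ j, hammingNorm (fun i => Q.HZ i j) ≤ ℓ)

/-- `G_X^ε = {y : |H_X y| ≤ ε m_X}`. -/
def GX (Q : CSSCode n mX mZ) (ε : ℝ) : Set (Fin n → ZMod 2) :=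
  {y | (hammingNorm (Q.HX.mulVec y) : ℝ) ≤ ε * mX}

/-- `G_Z^ε = {y : |H_Z y| ≤ ε m_Z}`. -/
def GZ (Q : CSSCode n mX mZ) (ε : ℝ) : Set (Fin n → ZMod 2) :=
  {y | (hammingNorm (Q.HZ.mulVec y) : ℝ) ≤ ε * mZ}

/-- The `(c₁, c₂, ε₀)`-clustering property. -/
def Clustering (Q : CSSCode n mX mZ) (c₁ c₂ ε₀ : ℝ) : Prop :=
  ∀ ε : ℝ, 0 < ε → ε < ε₀ →
    (∀ y ∈ Q.GX ε, (cosetWeight (dualCode Q.CZ) y : ℝ) ≤ c₁ * ε * n ∨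
      c₂ * n ≤ (cosetWeight (dualCode Q.CZ) y : ℝ)) ∧
    (∀ y ∈ Q.GZ ε, (cosetWeight (dualCode Q.CX) y : ℝ) ≤ c₁ * ε * n ∨
      c₂ * n ≤ (cosetWeight (dualCode Q.CX) y : ℝ))

/-- `(c₁, c₂)`-small-set boundary expansion. -/
def SmallSetBoundaryExpansion (Q : CSSCode n mX mZ) (c₁ c₂ : ℝ) : Prop :=
  ∀ y : Fin n → ZMod 2, (hammingNorm y : ℝ) ≤ c₁ * n →
    c₂ * ((cosetWeight (dualCode Q.CX) y : ℝ) / n) ≤ (hammingNorm (Q.HZ.mulVec y) : ℝ) / mZ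

/-- `(c₁, c₂)`-small-set coboundary expansion. -/
def SmallSetCoboundaryExpansion (Q : CSSCode n mX mZ) (c₁ c₂ : ℝ) : Prop :=
  ∀ y : Fin n → ZMod 2, (hammingNorm y : ℝ) ≤ c₁ * n →
    c₂ * ((cosetWeight (dualCode Q.CZ) y : ℝ) / n) ≤ (hammingNorm (Q.HX.mulVec y) : ℝ) / mX

end CSSCode

/-! ## Qubit systems -/

/-- Operators on the qubits indexed by `ι`, as matrices in the computational basis
`|x⟩`, `x : ι → ZMod 2`. -/
abbrev Op (ι : Type) : Type := Matrix (ι → ZMod 2) (ι → ZMod 2) ℂ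

section Qubits

variable {ι : Type} [Fintype ι] [DecidableEq ι]

/-- A (possibly mixed) state: a density matrix. -/
def IsState (ρ : Op ι) : Prop := ρ.PosSemidef ∧ ρ.trace = 1

/-- `X^a |y⟩ = |y + a⟩`. -/
def pauliX (a : ι → ZMod 2) : Op ι :=
  Matrix.of fun x y => if x = y + a then 1 else 0

/-- `Z^a |y⟩ = (-1)^(a · y) |y⟩`. -/
def pauliZ (a : ι → ZMod 2) : Op ι :=
  Matrix.diagonal fun y => (-1 : ℂ) ^ (a ⬝ᵥ y).val

/-- The operator `u ⊗ I` that applies `u` to the qubits in `S` and the identity to the others. -/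
def localOp (S : Finset ι) (u : Op S) : Op ι :=
  Matrix.of fun x y =>
    if ∀ i, i ∉ S → x i = y i then u (fun i => x i) (fun i => y i) else 0

/-- `H` is a sum of Hamiltonians, each acting nontrivially on at most `ℓ` qubits. -/
def IsLocalHamiltonian (ℓ : ℕ) (H : Op ι) : Prop :=
  ∃ (N : ℕ) (S : Fin N → Finset ι) (h : (i : Fin N) → Op (S i)),
    (∀ i, (S i).card ≤ ℓ) ∧ (∀ i, (h i).IsHermitian) ∧ H = ∑ i, localOp (S i) (h i)

/-- `ρ` is an `ε`-approximate ground state of `H`: a state with `Tr(ρ H) ≤ ε`. -/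
def IsApproxGroundState (H : Op ι) (ε : ℝ) (ρ : Op ι) : Prop :=
  IsState ρ ∧ (Matrix.trace (ρ * H)).re ≤ ε

end Qubits

/-- The code Hamiltonian `H = (H_X + H_Z) / 2`, where `H_X` is the average of `(I - X^y) / 2` over
the rows `y` of the first parity-check matrix and `H_Z` is the average of `(I - Z^y) / 2` over the
rows `y` of the second one. -/
def CSSCode.hamiltonian {n mX mZ : ℕ} (Q : CSSCode n mX mZ) : Op (Fin n) :=
  (1 / 2 : ℂ) •
    ((1 / (mX : ℂ)) • ∑ i, (1 / 2 : ℂ) • (1 - pauliX (Q.HX i)) +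
     (1 / (mZ : ℂ)) • ∑ i, (1 / 2 : ℂ) • (1 - pauliZ (Q.HZ i)))

/-! ## Quantum circuits -/

/-- A gate: an arbitrary unitary on at most two qubits. -/
structure Gate (ι : Type) [Fintype ι] [DecidableEq ι] where
  support : Finset ι
  card_le : support.card ≤ 2
  mat : Op support
  unitary : mat ∈ Matrix.unitaryGroup (support → ZMod 2) ℂ

/-- A layer: gates acting on pairwise disjoint sets of qubits. -/
structure Layer (ι : Type) [Fintype ι] [DecidableEq ι] where
  gates : List (Gate ι)
  disjoint : gates.Pairwise fun g h => Disjoint g.support h.support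

/-- The unitary implemented by a layer. -/
def Layer.toOp {ι : Type} [Fintype ι] [DecidableEq ι] (L : Layer ι) : Op ι :=
  (L.gates.map fun g => localOp g.support g.mat).prod

/-- A circuit: a sequence of layers, the head of the list being applied first. -/
abbrev Circuit (ι : Type) [Fintype ι] [DecidableEq ι] : Type := List (Layer ι)

/-- The depth of a circuit: its number of layers. -/
def Circuit.depth {ι : Type} [Fintype ι] [DecidableEq ι] (C : Circuit ι) : ℕ := C.length

/-- The unitary implemented by a circuit. -/
def Circuit.toOp {ι : Type} [Fintype ι] [DecidableEq ι] : Circuit ι → Op ι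
  | [] => 1
  | L :: C => Circuit.toOp C * L.toOp

/-- The pure state vector obtained by applying a circuit to the all-zero basis state. -/
def Circuit.outputVec {ι : Type} [Fintype ι] [DecidableEq ι] (C : Circuit ι) :
    (ι → ZMod 2) → ℂ :=
  (Circuit.toOp C).mulVec (Pi.single 0 1)

/-- The `n`-qubit state left when a circuit on `n + a` qubits is applied to the all-zero state and
the `a` ancilla qubits are traced out. -/
def Circuit.outputState {n a : ℕ} (C : Circuit (Fin n ⊕ Fin a)) : Op (Fin n) :=
  Matrix.of fun x y => ∑ z : Fin a → ZMod 2,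
    Circuit.outputVec C (Sum.elim x z) * star (Circuit.outputVec C (Sum.elim y z))

/-! ## NLTS Hamiltonians -/

/-- The minimum depth of a circuit, on at least `n` qubits, that constructs an `ε`-approximate
ground state of `H`. -/
def minDepth {n : ℕ} (H : Op (Fin n)) (ε : ℝ) : ℕ∞ :=
  sInf {t : ℕ∞ | ∃ (a : ℕ) (C : Circuit (Fin n ⊕ Fin a)),
    IsApproxGroundState H ε (Circuit.outputState C) ∧ t = (Circuit.depth C : ℕ∞)}

/-- A family of local Hamiltonians `0 ≤ H j ≤ I`, with `H j` on `n j` qubits, is NLTS if for some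
`ε > 0` the minimum depth of a circuit constructing an `ε`-approximate ground state of `H j`
tends to infinity. -/
def IsNLTS (n : ℕ → ℕ) (H : (j : ℕ) → Op (Fin (n j))) : Prop :=
  (∃ ℓ : ℕ, ∀ j, IsLocalHamiltonian ℓ (H j)) ∧
  (∀ j, (H j).PosSemidef ∧ (1 - H j).PosSemidef) ∧
  ∃ ε : ℝ, 0 < ε ∧ Tendsto (fun j => minDepth (H j) ε) atTop (𝓝 ⊤)

end NLTS

end

open Filter Topology
open scoped ComplexOrder

noncomputable section

namespace NLTS

/-! ## Signs and Pauli operators -/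

/-! Shallow circuits cannot produce spread-out measurement statistics, while an uncertainty relation
for logical operators forces low-energy states to be spread out in one of two bases.

Shallow circuits. Write the output as `U|0⟩`. If `g` ignores the light cone of the input qubit `i`,
then `g` commutes with `U Z_i U†`, so `U† g U` has no matrix element from `|0⟩` to a string `y` with
`y i = 1`. Comparing `f` with approximations `g i` of this kind gives a Poincaré inequality, `Var f
≤ ∑ i, ‖f - g i‖∞²` (`variance_le_sum_sq`). For `f` Lipschitz in the Hamming distance of the `n`
output bits, the right side is at most `n * 4 ^ t` at depth `t`, however many ancillas there are.
Hence two sets of mass `μ` at distance `D` satisfy `μ / 2 * D ^ 2 ≤ n * 4 ^ t`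
(`sq_dist_le_of_spread`). A final layer of Hadamards preserves supports, so the same holds in the
dual basis.

Low energy. In each basis, Markov's inequality puts most of the mass on words of small syndrome,
which clustering splits into far-apart classes. Either the distribution has two pieces of mass
`1/50` at distance `c₂ n`, or one class carries `9/10` (`exists_spread_or_concentrated`). In the
second case words of that class with equal syndrome differ by a stabilizer, so the syndrome
determines how to correct the sign of a logical operator, and the corrected sign has expectation at
least `4/5`. If this happened in both bases, an anticommuting logical pair would yield anticommuting
involutions with both expectations at least `4/5`, which is impossible
(`CSSCode.not_both_concentrated`). So some basis is spread, and `c₂² n ≤ 100 * 4 ^ t`, which is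
stronger than the logarithmic bound.

Small-set expansion, applied to minimum-weight coset representatives, gives clustering with
constants `1 / c₂`, `c₁` and a distance above `c₁ n`. The energy threshold is then a constant, and
the second claim follows. -/

/-- The sign `(-1)^a` of a bit. -/
def sgn (a : ZMod 2) : ℝ := (-1) ^ a.val

@[simp] lemma sgn_zero : sgn 0 = 1 := by simp [sgn]

@[simp] lemma sgn_one : sgn 1 = -1 := by simp [sgn, ZMod.val_one]

lemma bit_cases (a : ZMod 2) : a = 0 ∨ a = 1 := by
  revert a; decide

lemma bit_eq_one_of_ne_zero {a : ZMod 2} (h : a ≠ 0) : a = 1 := (bit_cases a).resolve_left h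

lemma sgn_add (a b : ZMod 2) : sgn (a + b) = sgn a * sgn b := by
  rcases bit_cases a with rfl | rfl <;> rcases bit_cases b with rfl | rfl <;>
    simp [show (1 : ZMod 2) + 1 = 0 from rfl]

@[simp] lemma sgn_mul_self (a : ZMod 2) : sgn a * sgn a = 1 := by
  rcases bit_cases a with rfl | rfl <;> simp

lemma one_sub_sgn_div_two (a : ZMod 2) : (1 - sgn a) / 2 = if a ≠ 0 then 1 else 0 := by
  rcases bit_cases a with rfl | rfl <;> norm_num

lemma add_self_bits {ι : Type*} (v : ι → ZMod 2) : v + v = 0 :=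
  funext fun i => CharTwo.add_self_eq_zero (v i)

lemma add_add_cancel_bits {ι : Type*} (x v : ι → ZMod 2) : x + v + v = x := by
  rw [add_assoc, add_self_bits, add_zero]

section Qubits

variable {ι : Type} [Fintype ι] [DecidableEq ι]

/-- The diagonal operator of a real function on the computational basis. -/
def diagOp (f : (ι → ZMod 2) → ℝ) : Op ι := Matrix.diagonal fun x => (f x : ℂ)

omit [DecidableEq ι] in
lemma pauliZ_eq_diagOp (a : ι → ZMod 2) : pauliZ a = diagOp fun y => sgn (a ⬝ᵥ y) := by
  simp [pauliZ, diagOp, sgn]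

lemma mul_pauliX_apply (A : Op ι) (v x y : ι → ZMod 2) :
    (A * pauliX v) x y = A x (y + v) := by
  simp [Matrix.mul_apply, pauliX]

lemma pauliX_mul_apply (A : Op ι) (v x y : ι → ZMod 2) :
    (pauliX v * A) x y = A (x + v) y := by
  have h : ∀ z : ι → ZMod 2, (x = z + v) ↔ (x + v = z) := fun z =>
    ⟨fun h => by rw [h, add_add_cancel_bits], fun h => by rw [← h, add_add_cancel_bits]⟩
  simp [Matrix.mul_apply, pauliX, h]

/-- The operators that act as the identity on all qubits outside `S`, described as the commutant
of the Pauli operators on those qubits. -/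
def supportedOn (S : Set ι) : Set (Op ι) :=
  {A | ∀ v : ι → ZMod 2, (∀ i ∈ S, v i = 0) → Commute A (pauliX v) ∧ Commute A (pauliZ v)}

lemma supportedOn_mono {S T : Set ι} (h : S ⊆ T) : supportedOn S ⊆ supportedOn T :=
  fun _ hA v hv => hA v fun i hi => hv i (h hi)

lemma mul_mem_supportedOn {S : Set ι} {A B : Op ι} (hA : A ∈ supportedOn S)
    (hB : B ∈ supportedOn S) : A * B ∈ supportedOn S :=
  fun v hv => ⟨(hA v hv).1.mul_left (hB v hv).1, (hA v hv).2.mul_left (hB v hv).2⟩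

lemma apply_add_add_of_mem_supportedOn {S : Set ι} {A : Op ι} (hA : A ∈ supportedOn S)
    {v : ι → ZMod 2} (hv : ∀ i ∈ S, v i = 0) (x y : ι → ZMod 2) :
    A (x + v) (y + v) = A x y := by
  have h := congrFun (congrFun (hA v hv).1.eq x) (y + v)
  rw [mul_pauliX_apply, pauliX_mul_apply, add_add_cancel_bits] at h
  exact h.symm

/-- Commutation with `Z` on qubit `i` multiplies the entry by `sgn (x i)` on one side and by `sgn (y
i)` on the other. -/
lemma apply_eq_zero_of_mem_supportedOn {S : Set ι} {A : Op ι} (hA : A ∈ supportedOn S)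
    {i : ι} (hi : i ∉ S) {x y : ι → ZMod 2} (hxy : x i ≠ y i) : A x y = 0 := by
  have hv : ∀ j ∈ S, (Pi.single i 1 : ι → ZMod 2) j = 0 := fun j hj => by
    rw [Pi.single_eq_of_ne]
    rintro rfl
    exact hi hj
  have h := congrFun (congrFun (hA _ hv).2.eq x) y
  rw [pauliZ_eq_diagOp, diagOp, Matrix.mul_diagonal, Matrix.diagonal_mul] at h
  simp only [single_dotProduct, one_mul] at h
  rcases bit_cases (x i) with hx | hx <;> rcases bit_cases (y i) with hy | hy <;>
    simp [hx, hy] at h hxy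
  · linear_combination (-1 / 2 : ℂ) * h
  · linear_combination (1 / 2 : ℂ) * h

lemma localOp_mem_supportedOn (S : Finset ι) (u : Op S) :
    localOp S u ∈ supportedOn (S : Set ι) := by
  intro v hv
  have hv' : ∀ z : ι → ZMod 2, (fun i : S => (z + v) i) = fun i : S => z i := fun z => by
    funext i
    simp [hv i i.2]
  constructor
  · ext x y
    rw [mul_pauliX_apply, pauliX_mul_apply]
    simp only [localOp, Matrix.of_apply, hv']
    refine if_congr (forall₂_congr fun i _ => ?_) rfl rfl
    simp only [Pi.add_apply]
    constructor <;> intro h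
    · rw [h, add_assoc, CharTwo.add_self_eq_zero, add_zero]
    · rw [← h, add_assoc, CharTwo.add_self_eq_zero, add_zero]
  · ext x y
    rw [pauliZ_eq_diagOp, diagOp, Matrix.mul_diagonal, Matrix.diagonal_mul]
    simp only [localOp, Matrix.of_apply]
    split_ifs with h
    · have : v ⬝ᵥ x = v ⬝ᵥ y := Finset.sum_congr rfl fun i _ => by
        by_cases hi : i ∈ S
        · simp [hv i hi]
        · rw [h i hi]
      rw [this, mul_comm]
    · simp

lemma pauliZ_single_mem_supportedOn (i : ι) :
    (pauliZ (Pi.single i 1) : Op ι) ∈ supportedOn {i} := by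
  intro v hv
  have hvi := hv i rfl
  constructor
  · ext x y
    rw [mul_pauliX_apply, pauliX_mul_apply, pauliZ_eq_diagOp, diagOp, Matrix.diagonal_apply,
      Matrix.diagonal_apply]
    have h : x = y + v ↔ x + v = y :=
      ⟨fun h => by rw [h, add_add_cancel_bits], fun h => by rw [← h, add_add_cancel_bits]⟩
    simp only [h, single_dotProduct, one_mul, Pi.add_apply, hvi, add_zero]
  · rw [pauliZ_eq_diagOp, pauliZ_eq_diagOp]
    exact Matrix.commute_diagonal _ _

lemma mul_localOp_apply (A : Op ι) (T : Finset ι) (u : Op T) {S : Set ι}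
    (hA : A ∈ supportedOn S) (hST : ∀ i ∈ T, i ∉ S) (x y : ι → ZMod 2) :
    (A * localOp T u) x y = A x (T.piecewise x y) * u (fun i => x i) (fun i => y i) := by
  -- `A` preserves the bits in `T` and the local operator preserves those outside, so one
  -- intermediate string survives.
  rw [Matrix.mul_apply, Finset.sum_eq_single (T.piecewise x y)]
  · simp only [localOp, Matrix.of_apply]
    rw [if_pos (fun i hi => by simp [hi])]
    simp
  · intro z _ hz
    by_cases h : ∀ i ∈ T, x i = z i
    · simp only [localOp, Matrix.of_apply]
      rw [if_neg, mul_zero]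
      intro h'
      apply hz
      funext i
      by_cases hi : i ∈ T
      · simp [hi, h i hi]
      · simp [hi, h' i hi]
    · push Not at h
      obtain ⟨i, hi, hxz⟩ := h
      rw [apply_eq_zero_of_mem_supportedOn hA (hST i hi) hxz, zero_mul]
  · simp

lemma localOp_mul_apply (A : Op ι) (T : Finset ι) (u : Op T) {S : Set ι}
    (hA : A ∈ supportedOn S) (hST : ∀ i ∈ T, i ∉ S) (x y : ι → ZMod 2) :
    (localOp T u * A) x y = u (fun i => x i) (fun i => y i) * A (T.piecewise y x) y := by
  rw [Matrix.mul_apply, Finset.sum_eq_single (T.piecewise y x)]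
  · simp only [localOp, Matrix.of_apply]
    rw [if_pos (fun i hi => by simp [hi])]
    simp
  · intro z _ hz
    by_cases h : ∀ i ∈ T, z i = y i
    · simp only [localOp, Matrix.of_apply]
      rw [if_neg, zero_mul]
      intro h'
      apply hz
      funext i
      by_cases hi : i ∈ T
      · simp [hi, h i hi]
      · simp [hi, h' i hi]
    · push Not at h
      obtain ⟨i, hi, hxz⟩ := h
      rw [apply_eq_zero_of_mem_supportedOn hA (hST i hi) hxz, mul_zero]
  · simp

lemma commute_localOp_of_mem_supportedOn {A : Op ι} {T : Finset ι} (u : Op T) {S : Set ι}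
    (hA : A ∈ supportedOn S) (hST : ∀ i ∈ T, i ∉ S) : Commute A (localOp T u) := by
  ext x y
  rw [mul_localOp_apply A T u hA hST, localOp_mul_apply A T u hA hST, mul_comm]
  congr 1
  -- Translating by `x + y` on `T` exchanges the bits of `x` and `y` there, and the entries of `A`
  -- are invariant under it.
  have hv : ∀ i ∈ S, (T.piecewise (x + y) 0 : ι → ZMod 2) i = 0 := fun i hi => by
    rw [Finset.piecewise_eq_of_notMem _ _ _ fun h => hST i h hi, Pi.zero_apply]
  rw [← apply_add_add_of_mem_supportedOn hA hv x]
  congr 1 <;> funext i <;> by_cases hi : i ∈ T <;> simp [hi]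
  · rw [← add_assoc, CharTwo.add_self_eq_zero, zero_add]
  · rw [← add_assoc, CharTwo.add_self_eq_zero, zero_add]

lemma localOp_one (S : Finset ι) : localOp S (1 : Op S) = 1 := by
  ext x y
  simp only [localOp, Matrix.of_apply, Matrix.one_apply]
  by_cases hxy : x = y
  · simp [hxy]
  · rw [if_neg hxy]
    split_ifs with h h'
    · exact absurd (funext fun i => if hi : i ∈ S then congrFun h' ⟨i, hi⟩ else h i hi) hxy
    · rfl
    · rfl

lemma conjTranspose_localOp (S : Finset ι) (u : Op S) :
    (localOp S u).conjTranspose = localOp S u.conjTranspose := by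
  ext x y
  simp only [localOp, Matrix.conjTranspose_apply, Matrix.of_apply, apply_ite star, star_zero]
  exact if_congr (forall₂_congr fun i _ => eq_comm) rfl rfl

lemma localOp_mul_localOp (S : Finset ι) (u v : Op S) :
    localOp S u * localOp S v = localOp S (u * v) := by
  ext x y
  rw [Matrix.mul_apply]
  simp only [localOp, Matrix.of_apply]
  split_ifs with h
  · rw [Matrix.mul_apply]
    symm
    -- Only intermediate strings agreeing with `x` off `S` contribute; these are the strings on `S`
    -- extended by `x`.
    refine Finset.sum_of_injOn (fun w i => if hi : i ∈ S then w ⟨i, hi⟩ else x i) ?_ (by simp) ?_ ?_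
    · intro w _ w' _ hw
      funext i
      simpa using congrFun hw i
    · intro z _ hz
      rw [if_neg, zero_mul]
      intro h'
      apply hz
      refine ⟨fun i => z i, by simp, ?_⟩
      funext i
      by_cases hi : i ∈ S
      · simp [hi]
      · simp [hi, h' i hi]
    · intro w _
      rw [if_pos (fun i hi => by simp [hi]), if_pos (fun i hi => by simp [hi, h i hi])]
      simp
  · refine Finset.sum_eq_zero fun z _ => ?_
    by_cases h1 : ∀ i, i ∉ S → x i = z i
    · have h2 : ¬ ∀ i, i ∉ S → z i = y i := fun h2 => h fun i hi => (h1 i hi).trans (h2 i hi)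
      simp only [if_neg h2, mul_zero]
    · simp only [if_neg h1, zero_mul]

/-! ## Light cones -/

lemma Gate.conjTranspose_mul_self (g : Gate ι) :
    (localOp g.support g.mat).conjTranspose * localOp g.support g.mat = 1 := by
  rw [conjTranspose_localOp, localOp_mul_localOp]
  have := Matrix.mem_unitaryGroup_iff'.1 g.unitary
  rw [Matrix.star_eq_conjTranspose] at this
  rw [this, localOp_one]

/-- The operator of a list of gates. -/
def gatesOp (l : List (Gate ι)) : Op ι := (l.map fun g => localOp g.support g.mat).prod

lemma gatesOp_cons (g : Gate ι) (l : List (Gate ι)) :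
    gatesOp (g :: l) = localOp g.support g.mat * gatesOp l := by simp [gatesOp]

lemma conjTranspose_gatesOp_mul_self (l : List (Gate ι)) :
    (gatesOp l).conjTranspose * gatesOp l = 1 := by
  induction l with
  | nil => simp [gatesOp]
  | cons g l ih =>
    rw [gatesOp_cons, Matrix.conjTranspose_mul, Matrix.mul_assoc,
      ← Matrix.mul_assoc (localOp _ _).conjTranspose, g.conjTranspose_mul_self, Matrix.one_mul, ih]

/-- Two qubits are adjacent in a layer if they are equal or in the support of a common gate. -/
def Layer.Adj (L : Layer ι) (i j : ι) : Prop :=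
  i = j ∨ ∃ g ∈ L.gates, i ∈ g.support ∧ j ∈ g.support

/-- A gate meeting `S` enlarges the support only by its own qubits. A gate missing `S` is also
disjoint from the other gates of the layer, hence from the support grown so far, so it commutes
through and cancels with its adjoint. -/
lemma gatesOp_conj_mem_supportedOn (l : List (Gate ι))
    (hl : l.Pairwise fun g h => Disjoint g.support h.support) {S : Set ι} {A : Op ι}
    (hA : A ∈ supportedOn S) :
    gatesOp l * A * (gatesOp l).conjTranspose ∈
      supportedOn {j | ∃ i ∈ S, i = j ∨ ∃ g ∈ l, i ∈ g.support ∧ j ∈ g.support} := by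
  induction l with
  | nil => simpa [gatesOp] using hA
  | cons g l ih =>
    rw [List.pairwise_cons] at hl
    have hB := ih hl.2
    set B := gatesOp l * A * (gatesOp l).conjTranspose with hBdef
    have hEq : gatesOp (g :: l) * A * (gatesOp (g :: l)).conjTranspose =
        localOp g.support g.mat * B * (localOp g.support g.mat).conjTranspose := by
      rw [gatesOp_cons, Matrix.conjTranspose_mul, hBdef]
      simp only [Matrix.mul_assoc]
    rw [hEq]
    have hmono : {j | ∃ i ∈ S, i = j ∨ ∃ g ∈ l, i ∈ g.support ∧ j ∈ g.support} ⊆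
        {j | ∃ i ∈ S, i = j ∨ ∃ g' ∈ g :: l, i ∈ g'.support ∧ j ∈ g'.support} := by
      rintro j ⟨i, hi, h | ⟨g', hg', h⟩⟩
      · exact ⟨i, hi, Or.inl h⟩
      · exact ⟨i, hi, Or.inr ⟨g', List.mem_cons_of_mem _ hg', h⟩⟩
    by_cases hmeet : ∃ i ∈ S, i ∈ g.support
    · obtain ⟨i, hi, hig⟩ := hmeet
      have hsub : (g.support : Set ι) ⊆
          {j | ∃ i ∈ S, i = j ∨ ∃ g' ∈ g :: l, i ∈ g'.support ∧ j ∈ g'.support} :=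
        fun j hj => ⟨i, hi, Or.inr ⟨g, List.mem_cons_self, hig, hj⟩⟩
      refine mul_mem_supportedOn (mul_mem_supportedOn
        (supportedOn_mono hsub (localOp_mem_supportedOn _ _)) (supportedOn_mono hmono hB)) ?_
      rw [conjTranspose_localOp]
      exact supportedOn_mono hsub (localOp_mem_supportedOn _ _)
    · have hdisj : ∀ j ∈ g.support,
          j ∉ {j | ∃ i ∈ S, i = j ∨ ∃ g ∈ l, i ∈ g.support ∧ j ∈ g.support} := by
        rintro j hj ⟨i, hi, rfl | ⟨g', hg', -, hj'⟩⟩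
        · exact hmeet ⟨i, hi, hj⟩
        · exact Finset.disjoint_left.1 (hl.1 g' hg') hj hj'
      have hunit := mul_eq_one_comm.1 g.conjTranspose_mul_self
      rw [← (commute_localOp_of_mem_supportedOn g.mat hB hdisj).eq, Matrix.mul_assoc, hunit,
        Matrix.mul_one]
      exact supportedOn_mono hmono hB

/-- The qubit `j` lies in the forward light cone of the qubit `i`. -/
def Circuit.Reach : Circuit ι → ι → ι → Prop
  | [], i, j => i = j
  | L :: C, i, j => ∃ k, L.Adj i k ∧ Circuit.Reach C k j

lemma Circuit.conjTranspose_toOp_mul_self (C : Circuit ι) :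
    C.toOp.conjTranspose * C.toOp = 1 := by
  induction C with
  | nil => simp [Circuit.toOp]
  | cons L C ih =>
    rw [Circuit.toOp, Matrix.conjTranspose_mul, Matrix.mul_assoc,
      ← Matrix.mul_assoc (Circuit.toOp C).conjTranspose, ih, Matrix.one_mul]
    exact conjTranspose_gatesOp_mul_self L.gates

lemma Circuit.conj_mem_supportedOn (C : Circuit ι) {S : Set ι} {A : Op ι}
    (hA : A ∈ supportedOn S) :
    C.toOp * A * C.toOp.conjTranspose ∈ supportedOn {j | ∃ i ∈ S, C.Reach i j} := by
  induction C generalizing S A with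
  | nil => simpa [Circuit.toOp, Circuit.Reach] using hA
  | cons L C ih =>
    have h := ih (gatesOp_conj_mem_supportedOn L.gates L.disjoint hA)
    have hEq : Circuit.toOp (L :: C) * A * (Circuit.toOp (L :: C)).conjTranspose =
        Circuit.toOp C * (gatesOp L.gates * A * (gatesOp L.gates).conjTranspose) *
          (Circuit.toOp C).conjTranspose := by
      rw [Circuit.toOp, Matrix.conjTranspose_mul]
      simp only [Matrix.mul_assoc]
      rfl
    rw [hEq]
    refine supportedOn_mono ?_ h
    rintro j ⟨k, ⟨i, hi, hik⟩, hkj⟩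
    exact ⟨i, hi, k, hik, hkj⟩

lemma Layer.exists_card_le_two (L : Layer ι) (i : ι) :
    ∃ s : Finset ι, s.card ≤ 2 ∧ ∀ j, L.Adj i j → j ∈ s := by
  by_cases h : ∃ g ∈ L.gates, i ∈ g.support
  · obtain ⟨g, hg, hi⟩ := h
    refine ⟨g.support, g.card_le, ?_⟩
    rintro j (rfl | ⟨g', hg', hi', hj⟩)
    · exact hi
    · by_cases hgg : g = g'
      · rwa [hgg]
      · have hsymm : Std.Symm fun g h : Gate ι => Disjoint g.support h.support :=
          ⟨fun _ _ h => h.symm⟩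
        have := L.disjoint.forall hg hg' hgg
        exact absurd hi' (Finset.disjoint_left.1 this hi)
  · refine ⟨{i}, by simp, ?_⟩
    rintro j (rfl | ⟨g', hg', hi', -⟩)
    · simp
    · exact absurd ⟨g', hg', hi'⟩ h

lemma Layer.Adj.symm {L : Layer ι} {i j : ι} : L.Adj i j → L.Adj j i
  | Or.inl h => Or.inl h.symm
  | Or.inr ⟨g, hg, hi, hj⟩ => Or.inr ⟨g, hg, hj, hi⟩

lemma Circuit.exists_forward_cone (C : Circuit ι) (i : ι) :
    ∃ s : Finset ι, s.card ≤ 2 ^ C.depth ∧ ∀ j, C.Reach i j → j ∈ s := by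
  induction C generalizing i with
  | nil => exact ⟨{i}, by simp [Circuit.depth], fun j h => Finset.mem_singleton.2 (Eq.symm h)⟩
  | cons L C ih =>
    obtain ⟨s, hs, hsub⟩ := L.exists_card_le_two i
    choose t ht htsub using ih
    refine ⟨s.biUnion t, ?_, ?_⟩
    · calc (s.biUnion t).card ≤ s.card * 2 ^ Circuit.depth C :=
            Finset.card_biUnion_le_card_mul _ _ _ fun k _ => ht k
        _ ≤ 2 * 2 ^ Circuit.depth C := by gcongr
        _ = 2 ^ Circuit.depth (L :: C) := by simp [Circuit.depth, pow_succ']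
    · rintro j ⟨k, hik, hkj⟩
      exact Finset.mem_biUnion.2 ⟨k, hsub k hik, htsub k j hkj⟩

lemma Circuit.exists_backward_cone (C : Circuit ι) (j : ι) :
    ∃ s : Finset ι, s.card ≤ 2 ^ C.depth ∧ ∀ i, C.Reach i j → i ∈ s := by
  induction C with
  | nil => exact ⟨{j}, by simp [Circuit.depth], fun i h => Finset.mem_singleton.2 h⟩
  | cons L C ih =>
    obtain ⟨s, hs, hsub⟩ := ih
    choose t ht htsub using L.exists_card_le_two
    refine ⟨s.biUnion t, ?_, ?_⟩
    · calc (s.biUnion t).card ≤ s.card * 2 :=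
            Finset.card_biUnion_le_card_mul _ _ _ fun k _ => ht k
        _ ≤ 2 ^ Circuit.depth C * 2 := by gcongr
        _ = 2 ^ Circuit.depth (L :: C) := by simp [Circuit.depth, pow_succ]
    · rintro i ⟨k, hik, hkj⟩
      exact Finset.mem_biUnion.2 ⟨k, hsub k hkj, htsub k i hik.symm⟩

end Qubits

/-! ## The Hadamard transform -/

section Hadamard

variable {ι : Type} [Fintype ι] [DecidableEq ι]

/-- The tensor product of the Hadamard gates on all qubits. -/
def hadamard : Op ι :=
  Matrix.of fun x y => (((√(2 ^ Fintype.card ι))⁻¹ * sgn (x ⬝ᵥ y) : ℝ) : ℂ)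

lemma sum_sgn_dotProduct {v : ι → ZMod 2} (hv : v ≠ 0) :
    ∑ z : ι → ZMod 2, sgn (v ⬝ᵥ z) = 0 := by
  obtain ⟨i, hi⟩ := Function.ne_iff.1 hv
  have h : ∑ z : ι → ZMod 2, sgn (v ⬝ᵥ z) = ∑ z : ι → ZMod 2, -sgn (v ⬝ᵥ z) := by
    refine Fintype.sum_equiv (Equiv.addRight (Pi.single i 1)) _ _ fun z => ?_
    simp [dotProduct_add, sgn_add, bit_eq_one_of_ne_zero hi]
  rw [Finset.sum_neg_distrib] at h
  linarith

omit [DecidableEq ι] in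
lemma hadamard_scale_sq :
    (√(2 ^ Fintype.card ι) : ℝ)⁻¹ * (√(2 ^ Fintype.card ι))⁻¹ * 2 ^ Fintype.card ι = 1 := by
  have h : (0 : ℝ) < 2 ^ Fintype.card ι := by positivity
  rw [← mul_inv, Real.mul_self_sqrt h.le, inv_mul_cancel₀ h.ne']

lemma hadamard_mul_self : (hadamard : Op ι) * hadamard = 1 := by
  ext x y
  rw [Matrix.mul_apply]
  simp only [hadamard, Matrix.of_apply]
  have h : ∀ z : ι → ZMod 2, (√(2 ^ Fintype.card ι))⁻¹ * sgn (x ⬝ᵥ z) *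
      ((√(2 ^ Fintype.card ι))⁻¹ * sgn (z ⬝ᵥ y)) =
      ((√(2 ^ Fintype.card ι))⁻¹ * (√(2 ^ Fintype.card ι))⁻¹) * sgn ((x + y) ⬝ᵥ z) := fun z => by
    rw [add_dotProduct, sgn_add, dotProduct_comm z y]
    ring
  simp only [← Complex.ofReal_mul, h, ← Complex.ofReal_sum, ← Finset.mul_sum]
  by_cases hxy : x = y
  · subst hxy
    simp only [add_self_bits, zero_dotProduct, sgn_zero, Finset.sum_const, Finset.card_univ,
      Fintype.card_fun, ZMod.card, nsmul_eq_mul, mul_one, Nat.cast_pow, Nat.cast_ofNat,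
      hadamard_scale_sq, Matrix.one_apply_eq, Complex.ofReal_one]
  · rw [sum_sgn_dotProduct, mul_zero, Matrix.one_apply_ne hxy, Complex.ofReal_zero]
    intro h
    apply hxy
    rw [← add_add_cancel_bits x y, h, zero_add]

omit [DecidableEq ι] in
lemma conjTranspose_hadamard : (hadamard : Op ι).conjTranspose = hadamard := by
  ext x y
  simp [hadamard, Matrix.conjTranspose_apply, dotProduct_comm x y]

lemma hadamard_mul_pauliX (v : ι → ZMod 2) : hadamard * pauliX v = pauliZ v * hadamard := by
  ext x y
  rw [mul_pauliX_apply, pauliZ_eq_diagOp, diagOp, Matrix.diagonal_mul]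
  simp only [hadamard, Matrix.of_apply, ← Complex.ofReal_mul, dotProduct_add, sgn_add,
    dotProduct_comm x v]
  congr 1
  ring

lemma hadamard_mul_pauliZ (v : ι → ZMod 2) : hadamard * pauliZ v = pauliX v * hadamard := by
  calc hadamard * pauliZ v = hadamard * (pauliZ v * hadamard) * hadamard := by
        rw [Matrix.mul_assoc, Matrix.mul_assoc, hadamard_mul_self, Matrix.mul_one]
    _ = pauliX v * hadamard := by
        rw [← hadamard_mul_pauliX, ← Matrix.mul_assoc, hadamard_mul_self, Matrix.one_mul]

lemma pauliX_eq_conj (v : ι → ZMod 2) : pauliX v = hadamard * pauliZ v * hadamard := by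
  rw [hadamard_mul_pauliZ, Matrix.mul_assoc, hadamard_mul_self, Matrix.mul_one]

/-- Conjugation by `hadamard` exchanges `X^v` and `Z^v`, and the commutant defining `supportedOn` is
symmetric in the two. -/
lemma hadamard_conj_mem_supportedOn {S : Set ι} {A : Op ι} (hA : A ∈ supportedOn S) :
    hadamard * A * hadamard ∈ supportedOn S := by
  intro v hv
  obtain ⟨hX, hZ⟩ := hA v hv
  constructor
  · calc hadamard * A * hadamard * pauliX v = hadamard * (A * pauliZ v) * hadamard := by
          simp only [Matrix.mul_assoc, hadamard_mul_pauliX]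
      _ = pauliX v * (hadamard * A * hadamard) := by
          rw [hZ.eq]
          simp only [← Matrix.mul_assoc, hadamard_mul_pauliZ]
  · calc hadamard * A * hadamard * pauliZ v = hadamard * (A * pauliX v) * hadamard := by
          simp only [Matrix.mul_assoc, hadamard_mul_pauliZ]
      _ = pauliZ v * (hadamard * A * hadamard) := by
          rw [hX.eq]
          simp only [← Matrix.mul_assoc, hadamard_mul_pauliX]

/-! ## A Poincaré inequality for states with small light cones -/

lemma ofReal_sum_norm_sq {κ : Type*} [Fintype κ] (v : κ → ℂ) :
    ((∑ x, ‖v x‖ ^ 2 : ℝ) : ℂ) = star v ⬝ᵥ v := by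
  simp [dotProduct, Complex.conj_mul']

lemma sum_norm_sq_mulVec {κ : Type*} [Fintype κ] [DecidableEq κ] {U : Matrix κ κ ℂ}
    (hU : U.conjTranspose * U = 1) (v : κ → ℂ) :
    ∑ x, ‖U.mulVec v x‖ ^ 2 = ∑ x, ‖v x‖ ^ 2 := by
  apply Complex.ofReal_injective
  rw [ofReal_sum_norm_sq, ofReal_sum_norm_sq, Matrix.star_mulVec, ← Matrix.dotProduct_mulVec,
    Matrix.mulVec_mulVec, hU, Matrix.one_mulVec]

lemma commute_diagOp_of_mem_supportedOn {S : Set ι} {A : Op ι} (hA : A ∈ supportedOn S)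
    {g : (ι → ZMod 2) → ℝ} (hg : ∀ x y, (∀ j ∉ S, x j = y j) → g x = g y) :
    Commute (diagOp g) A := by
  ext x y
  rw [diagOp, Matrix.diagonal_mul, Matrix.mul_diagonal]
  by_cases h : ∀ j ∉ S, x j = y j
  · rw [hg x y h, mul_comm]
  · push Not at h
    obtain ⟨i, hi, hxy⟩ := h
    rw [apply_eq_zero_of_mem_supportedOn hA hi hxy, zero_mul, mul_zero]

lemma diagOp_mulVec (f : (ι → ZMod 2) → ℝ) (v : (ι → ZMod 2) → ℂ) (x : ι → ZMod 2) :
    (diagOp f).mulVec v x = f x * v x := by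
  rw [diagOp, Matrix.mulVec_diagonal]

/-- The function `g` ignores the bits in `S`, so it commutes with the evolved `Z_i`; pulled back
through `U`, it commutes with `Z_i` and cannot flip bit `i` of the zero string. -/
lemma conj_diagOp_apply_zero_eq_zero {U : Op ι} (hU : U.conjTranspose * U = 1) {i : ι}
    {S : Set ι} (hS : U * pauliZ (Pi.single i 1) * U.conjTranspose ∈ supportedOn S)
    {g : (ι → ZMod 2) → ℝ} (hg : ∀ x y, (∀ j ∉ S, x j = y j) → g x = g y)
    {y : ι → ZMod 2} (hy : y i = 1) :
    (U.conjTranspose * diagOp g * U) y 0 = 0 := by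
  set B := U.conjTranspose * diagOp g * U with hB
  have hcomm : B * pauliZ (Pi.single i 1) = pauliZ (Pi.single i 1) * B := by
    calc B * pauliZ (Pi.single i 1)
        = U.conjTranspose * (diagOp g * (U * pauliZ (Pi.single i 1) * U.conjTranspose)) * U := by
          simp only [hB, Matrix.mul_assoc, hU, Matrix.mul_one]
      _ = (U.conjTranspose * U) * pauliZ (Pi.single i 1) * B := by
          rw [(commute_diagOp_of_mem_supportedOn hS hg).eq]
          simp only [hB, Matrix.mul_assoc]
      _ = pauliZ (Pi.single i 1) * B := by rw [hU, Matrix.one_mul]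
  have h := congrFun (congrFun hcomm y) 0
  rw [pauliZ_eq_diagOp, diagOp, Matrix.mul_diagonal, Matrix.diagonal_mul] at h
  simp only [single_dotProduct, one_mul, hy, Pi.zero_apply, sgn_zero, sgn_one] at h
  push_cast at h
  linear_combination (1 / 2 : ℂ) * h

/-- With `φ = U† f U|0⟩`, the second moment of `f` is `‖φ‖²` and its mean is `φ 0`. The variance is
therefore the weight of `φ` on nonzero strings, bounded by summing over `i` its weight on strings
with `y i = 1`. -/
lemma variance_le_sum_sq {U : Op ι} (hU : U.conjTranspose * U = 1) {S : ι → Set ι}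
    (hS : ∀ i, U * pauliZ (Pi.single i 1) * U.conjTranspose ∈ supportedOn (S i))
    {ψ : (ι → ZMod 2) → ℂ} (hψ : ψ = U.mulVec (Pi.single 0 1))
    (f : (ι → ZMod 2) → ℝ) (g : ι → (ι → ZMod 2) → ℝ) (b : ι → ℝ)
    (hg : ∀ i x y, (∀ j ∉ S i, x j = y j) → g i x = g i y)
    (hfg : ∀ i x, |f x - g i x| ≤ b i) :
    ∑ x, ‖ψ x‖ ^ 2 * f x ^ 2 - (∑ x, ‖ψ x‖ ^ 2 * f x) ^ 2 ≤ ∑ i, b i ^ 2 := by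
  have hU' : U.conjTranspose.conjTranspose * U.conjTranspose = 1 := by
    rw [Matrix.conjTranspose_conjTranspose]
    exact mul_eq_one_comm.1 hU
  have hψnorm : ∑ x, ‖ψ x‖ ^ 2 = 1 := by
    rw [hψ, sum_norm_sq_mulVec hU, Finset.sum_eq_single 0]
    · simp
    · intro x _ hx
      simp [hx]
    · simp
  have hψ0 : ∀ x, ψ x = U x 0 := fun x => by simp [hψ]
  set φ := U.conjTranspose.mulVec ((diagOp f).mulVec ψ) with hφ
  have hφnorm : ∑ x, ‖φ x‖ ^ 2 = ∑ x, ‖ψ x‖ ^ 2 * f x ^ 2 := by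
    rw [hφ, sum_norm_sq_mulVec hU']
    refine Finset.sum_congr rfl fun x _ => ?_
    rw [diagOp_mulVec, norm_mul, Complex.norm_real, mul_pow, Real.norm_eq_abs, sq_abs, mul_comm]
  have hφ0 : φ 0 = ((∑ x, ‖ψ x‖ ^ 2 * f x : ℝ) : ℂ) := by
    rw [hφ, Matrix.mulVec, dotProduct]
    push_cast
    refine Finset.sum_congr rfl fun x _ => ?_
    rw [diagOp_mulVec, Matrix.conjTranspose_apply, ← hψ0, ← Complex.conj_mul']
    simp only [RCLike.star_def]
    ring
  have hφ0' : ‖φ 0‖ ^ 2 = (∑ x, ‖ψ x‖ ^ 2 * f x) ^ 2 := by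
    rw [hφ0, Complex.norm_real, Real.norm_eq_abs, sq_abs]
  rw [← hφnorm, ← hφ0']
  -- On strings with `y i = 1` the function `g i` contributes nothing, so `f` may be replaced by `f
  -- - g i`.
  have hstep : ∀ i, ∑ y, (if y i = 1 then ‖φ y‖ ^ 2 else 0) ≤ b i ^ 2 := by
    intro i
    set χ := U.conjTranspose.mulVec ((diagOp fun x => f x - g i x).mulVec ψ) with hχ
    have hχφ : ∀ y, y i = 1 → φ y = χ y := by
      intro y hy
      have hz : U.conjTranspose.mulVec ((diagOp (g i)).mulVec ψ) y = 0 := by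
        rw [hψ, Matrix.mulVec_mulVec, Matrix.mulVec_mulVec, Matrix.mulVec_single_one]
        exact conj_diagOp_apply_zero_eq_zero hU (hS i) (hg i) hy
      have hsub : (diagOp fun x => f x - g i x).mulVec ψ =
          (diagOp f).mulVec ψ - (diagOp (g i)).mulVec ψ := by
        funext x
        simp only [Pi.sub_apply, diagOp_mulVec]
        push_cast
        ring
      rw [hχ, hsub, Matrix.mulVec_sub, Pi.sub_apply, hz, sub_zero]
    calc ∑ y, (if y i = 1 then ‖φ y‖ ^ 2 else 0) ≤ ∑ y, ‖χ y‖ ^ 2 := by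
          refine Finset.sum_le_sum fun y _ => ?_
          split_ifs with h
          · rw [hχφ y h]
          · positivity
      _ = ∑ x, ‖(diagOp fun x => f x - g i x).mulVec ψ x‖ ^ 2 := by
          rw [hχ, sum_norm_sq_mulVec hU']
      _ ≤ ∑ x, b i ^ 2 * ‖ψ x‖ ^ 2 := by
          refine Finset.sum_le_sum fun x _ => ?_
          rw [diagOp_mulVec, norm_mul, Complex.norm_real, mul_pow, Real.norm_eq_abs]
          gcongr
          exact hfg i x
      _ = b i ^ 2 := by rw [← Finset.mul_sum, hψnorm, mul_one]
  calc ∑ y, ‖φ y‖ ^ 2 - ‖φ 0‖ ^ 2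
      = ∑ y ∈ Finset.univ.erase 0, ‖φ y‖ ^ 2 := by
        rw [← Finset.sum_erase_add _ _ (Finset.mem_univ 0), add_sub_cancel_right]
    _ ≤ ∑ y ∈ Finset.univ.erase 0, ∑ i, (if y i = 1 then ‖φ y‖ ^ 2 else 0) := by
        refine Finset.sum_le_sum fun y hy => ?_
        obtain ⟨i, hi⟩ := Function.ne_iff.1 (Finset.ne_of_mem_erase hy)
        refine le_trans ?_ (Finset.single_le_sum (fun j _ => ?_) (Finset.mem_univ i))
        · rw [if_pos (bit_eq_one_of_ne_zero hi)]
        · split_ifs <;> positivity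
    _ ≤ ∑ y, ∑ i, (if y i = 1 then ‖φ y‖ ^ 2 else 0) := by
        refine Finset.sum_le_sum_of_subset_of_nonneg (Finset.erase_subset _ _) fun y _ _ =>
          Finset.sum_nonneg fun i _ => ?_
        split_ifs <;> positivity
    _ = ∑ i, ∑ y, (if y i = 1 then ‖φ y‖ ^ 2 else 0) := Finset.sum_comm
    _ ≤ ∑ i, b i ^ 2 := Finset.sum_le_sum fun i _ => hstep i

end Hadamard

/-! ## Outputs of shallow circuits are not spread -/

section Spread

variable {n a : ℕ}

/-- The distribution of the first `n` bits when `ψ` is measured in the computational basis. -/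
def marginal (ψ : (Fin n ⊕ Fin a → ZMod 2) → ℂ) (x : Fin n → ZMod 2) : ℝ :=
  ∑ z : Fin a → ZMod 2, ‖ψ (Sum.elim x z)‖ ^ 2

lemma sum_norm_sq_mul_eq_sum_marginal (ψ : (Fin n ⊕ Fin a → ZMod 2) → ℂ)
    (f : (Fin n → ZMod 2) → ℝ) :
    ∑ x, ‖ψ x‖ ^ 2 * f (fun j => x (Sum.inl j)) = ∑ x, marginal ψ x * f x := by
  rw [← (Equiv.sumArrowEquivProdArrow (Fin n) (Fin a) (ZMod 2)).symm.sum_comp,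
    Fintype.sum_prod_type]
  refine Finset.sum_congr rfl fun x _ => ?_
  rw [marginal, Finset.sum_mul]
  rfl

lemma marginal_nonneg (ψ : (Fin n ⊕ Fin a → ZMod 2) → ℂ) (x : Fin n → ZMod 2) :
    0 ≤ marginal ψ x := Finset.sum_nonneg fun _ _ => by positivity

open Classical in
/-- The number of output bits in the forward light cone of the qubit `i`. -/
def Circuit.coneCard (C : Circuit (Fin n ⊕ Fin a)) (i : Fin n ⊕ Fin a) : ℕ :=
  (Finset.univ.filter fun j : Fin n => C.Reach i (Sum.inl j)).card

/-- One factor is bounded by the largest forward cone. The remaining sum is counted from the output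
side, where each of the `n` bits has at most `2 ^ depth` ancestors, so ancillas cost nothing. -/
lemma Circuit.sum_coneCard_sq_le (C : Circuit (Fin n ⊕ Fin a)) :
    ∑ i, (C.coneCard i : ℝ) ^ 2 ≤ n * 4 ^ C.depth := by
  classical
  have h1 : ∀ i, C.coneCard i ≤ 2 ^ C.depth := by
    intro i
    obtain ⟨s, hs, hsub⟩ := C.exists_forward_cone i
    refine le_trans (Finset.card_le_card_of_injOn Sum.inl ?_ Sum.inl_injective.injOn) hs
    intro j hj
    exact hsub _ (by simpa using hj)
  have h2 : ∑ i, C.coneCard i ≤ n * 2 ^ C.depth := by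
    have h := Finset.sum_card_bipartiteAbove_eq_sum_card_bipartiteBelow
      (s := (Finset.univ : Finset (Fin n ⊕ Fin a))) (t := (Finset.univ : Finset (Fin n)))
      (fun i j => C.Reach i (Sum.inl j))
    simp only [Finset.bipartiteAbove, Finset.bipartiteBelow] at h
    simp only [Circuit.coneCard]
    rw [h]
    calc _ ≤ ∑ _j : Fin n, 2 ^ C.depth := by
          refine Finset.sum_le_sum fun j _ => ?_
          obtain ⟨s, hs, hsub⟩ := C.exists_backward_cone (Sum.inl j)
          refine le_trans (Finset.card_le_card ?_) hs
          intro i hi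
          exact hsub _ (by simpa using hi)
      _ = n * 2 ^ C.depth := by simp
  have h3 : ∑ i, C.coneCard i ^ 2 ≤ n * 4 ^ C.depth := by
    calc ∑ i, C.coneCard i ^ 2 ≤ ∑ i, 2 ^ C.depth * C.coneCard i :=
          Finset.sum_le_sum fun i _ => by
            rw [sq]
            exact Nat.mul_le_mul_right _ (h1 i)
      _ ≤ 2 ^ C.depth * (n * 2 ^ C.depth) := by
          rw [← Finset.mul_sum]
          exact Nat.mul_le_mul_left _ h2
      _ = n * 4 ^ C.depth := by
          rw [show 4 = 2 * 2 from rfl, mul_pow]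
          ring
  exact_mod_cast h3

/-- The Hamming distance to `S`, truncated at `D`. -/
lemma exists_lipschitz_separator (S : Set (Fin n → ZMod 2)) (hS : S.Nonempty) {D : ℝ}
    (hD : 0 ≤ D) :
    ∃ f : (Fin n → ZMod 2) → ℝ, (∀ x ∈ S, f x = 0) ∧
      (∀ y, (∀ x ∈ S, D ≤ hammingDist x y) → f y = D) ∧
      ∀ x y, |f x - f y| ≤ hammingDist x y := by
  let S' : Set (Hamming fun _ : Fin n => ZMod 2) := Hamming.ofHamming ⁻¹' S
  have hS' : S'.Nonempty := hS
  refine ⟨fun x => min (Metric.infDist (Hamming.toHamming x) S') D, fun x hx => ?_,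
    fun y hy => ?_, fun x y => ?_⟩
  · have : Metric.infDist (Hamming.toHamming x) S' = 0 := Metric.infDist_zero_of_mem hx
    simp [this, hD]
  · refine min_eq_right ((Metric.le_infDist hS').2 fun z hz => ?_)
    rw [dist_comm, Hamming.dist_eq_hammingDist]
    exact hy _ hz
  · refine (abs_min_sub_min_le_max _ _ _ _).trans ?_
    rw [sub_self, abs_zero, max_eq_left (abs_nonneg _), abs_sub_le_iff]
    have hxy := Metric.infDist_le_infDist_add_dist (s := S') (x := Hamming.toHamming x)
      (y := Hamming.toHamming y)
    have hyx := Metric.infDist_le_infDist_add_dist (s := S') (x := Hamming.toHamming y)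
      (y := Hamming.toHamming x)
    rw [dist_comm] at hyx
    rw [Hamming.dist_eq_hammingDist, Hamming.ofHamming_toHamming, Hamming.ofHamming_toHamming]
      at hxy hyx
    constructor <;> linarith

lemma le_variance_of_two_values {κ : Type*} [Fintype κ] [DecidableEq κ] {p f : κ → ℝ}
    (hp : ∀ x, 0 ≤ p x) (hp1 : ∑ x, p x = 1) {S T : Finset κ} (hST : Disjoint S T) {D μ : ℝ}
    (hfS : ∀ x ∈ S, f x = 0) (hfT : ∀ x ∈ T, f x = D)
    (hS : μ ≤ ∑ x ∈ S, p x) (hT : μ ≤ ∑ x ∈ T, p x) :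
    μ / 2 * D ^ 2 ≤ ∑ x, p x * f x ^ 2 - (∑ x, p x * f x) ^ 2 := by
  set m := ∑ x, p x * f x with hm
  have hvar : ∑ x, p x * f x ^ 2 - m ^ 2 = ∑ x, p x * (f x - m) ^ 2 := by
    have : ∀ x, p x * (f x - m) ^ 2 = p x * f x ^ 2 - 2 * m * (p x * f x) + m ^ 2 * p x :=
      fun x => by ring
    simp only [this, Finset.sum_add_distrib, Finset.sum_sub_distrib, ← Finset.mul_sum, hp1, ← hm]
    ring
  have hle : ∑ x ∈ S ∪ T, p x * (f x - m) ^ 2 ≤ ∑ x, p x * (f x - m) ^ 2 :=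
    Finset.sum_le_sum_of_subset_of_nonneg (Finset.subset_univ _) fun x _ _ =>
      mul_nonneg (hp x) (sq_nonneg _)
  rw [Finset.sum_union hST] at hle
  have h1 : ∑ x ∈ S, p x * (f x - m) ^ 2 = (∑ x ∈ S, p x) * m ^ 2 := by
    rw [Finset.sum_mul]
    exact Finset.sum_congr rfl fun x hx => by rw [hfS x hx]; ring
  have h2 : ∑ x ∈ T, p x * (f x - m) ^ 2 = (∑ x ∈ T, p x) * (D - m) ^ 2 := by
    rw [Finset.sum_mul]
    exact Finset.sum_congr rfl fun x hx => by rw [hfT x hx]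
  rw [hvar]
  by_cases hμ : 0 ≤ μ
  -- The identity behind this is `m² + (D - m)² = (D² + (D - 2m)²) / 2`.
  · nlinarith [mul_le_mul_of_nonneg_right hS (sq_nonneg m),
      mul_le_mul_of_nonneg_right hT (sq_nonneg (D - m)), mul_nonneg hμ (sq_nonneg (D - 2 * m))]
  · refine le_trans (mul_nonpos_of_nonpos_of_nonneg (by linarith) (sq_nonneg D))
      (Finset.sum_nonneg fun x _ => mul_nonneg (hp x) (sq_nonneg _))

lemma sq_dist_le_of_spread (C : Circuit (Fin n ⊕ Fin a)) {U : Op (Fin n ⊕ Fin a)}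
    (hU : U.conjTranspose * U = 1)
    (hcone : ∀ i, U * pauliZ (Pi.single i 1) * U.conjTranspose ∈ supportedOn {j | C.Reach i j})
    {ψ : (Fin n ⊕ Fin a → ZMod 2) → ℂ} (hψ : ψ = U.mulVec (Pi.single 0 1))
    {S T : Finset (Fin n → ZMod 2)} {D μ : ℝ} (hD : 0 < D) (hμ : 0 < μ)
    (hdist : ∀ x ∈ S, ∀ y ∈ T, D ≤ hammingDist x y)
    (hS : μ ≤ ∑ x ∈ S, marginal ψ x) (hT : μ ≤ ∑ x ∈ T, marginal ψ x) :
    μ / 2 * D ^ 2 ≤ n * 4 ^ C.depth := by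
  classical
  have hSne : S.Nonempty := by
    by_contra h
    rw [Finset.not_nonempty_iff_eq_empty.1 h, Finset.sum_empty] at hS
    linarith
  obtain ⟨f, hfS, hfT, hfL⟩ := exists_lipschitz_separator (S : Set (Fin n → ZMod 2)) hSne hD.le
  have hST : Disjoint S T := Finset.disjoint_left.2 fun x hx hx' => by
    have := hdist x hx x hx'
    rw [hammingDist_self, Nat.cast_zero] at this
    linarith
  have hsum : ∑ x, marginal ψ x = 1 := by
    have h := sum_norm_sq_mul_eq_sum_marginal ψ fun _ => 1
    simp only [mul_one] at h
    rw [← h, hψ, sum_norm_sq_mulVec hU, Finset.sum_eq_single 0]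
    · simp
    · intro x _ hx
      simp [hx]
    · simp
  refine (le_variance_of_two_values (marginal_nonneg ψ) hsum hST (fun x hx => hfS x hx)
    (fun y hy => hfT y fun x hx => hdist x hx y hy) hS hT).trans ?_
  rw [← sum_norm_sq_mul_eq_sum_marginal ψ f, ← sum_norm_sq_mul_eq_sum_marginal ψ fun x => f x ^ 2]
  -- The approximation to `f` zeroes the output bits in the cone of `i`; this changes at most
  -- `coneCard i` bits, so the Lipschitz bound applies.
  refine le_trans (variance_le_sum_sq hU hcone hψ (fun x => f fun j => x (Sum.inl j))
    (fun i x => f fun j => if C.Reach i (Sum.inl j) then 0 else x (Sum.inl j))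
    (fun i => C.coneCard i) ?_ ?_) C.sum_coneCard_sq_le
  · intro i x y hxy
    congr 1
    funext j
    split_ifs with h
    · rfl
    · exact hxy _ h
  · intro i x
    refine (hfL _ _).trans ?_
    rw [Nat.cast_le, hammingDist, Circuit.coneCard]
    refine Finset.card_le_card fun j hj => ?_
    simp only [Finset.mem_filter, Finset.mem_univ, true_and] at hj ⊢
    by_contra h
    exact hj (by rw [if_neg h])

end Spread

/-! ## Measurement statistics of states -/

section States

variable {n : ℕ}

/-- The distribution of the outcome when `ρ` is measured in the computational basis. -/
def prob (ρ : Op (Fin n)) (x : Fin n → ZMod 2) : ℝ := (ρ x x).re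

lemma IsState.prob_nonneg {ρ : Op (Fin n)} (hρ : IsState ρ) (x : Fin n → ZMod 2) :
    0 ≤ prob ρ x := (Complex.le_def.1 (hρ.1.diag_nonneg (i := x))).1

lemma IsState.sum_prob {ρ : Op (Fin n)} (hρ : IsState ρ) : ∑ x, prob ρ x = 1 := by
  have h := congrArg Complex.re hρ.2
  rw [Matrix.trace, Complex.re_sum] at h
  exact h

lemma trace_mul_diagOp_re (ρ : Op (Fin n)) (f : (Fin n → ZMod 2) → ℝ) :
    (Matrix.trace (ρ * diagOp f)).re = ∑ x, prob ρ x * f x := by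
  rw [Matrix.trace, Complex.re_sum]
  refine Finset.sum_congr rfl fun x _ => ?_
  rw [Matrix.diag_apply, diagOp, Matrix.mul_diagonal, Complex.re_mul_ofReal, prob]

/-- The Hadamard transform of an operator. -/
def hadamardConj (ρ : Op (Fin n)) : Op (Fin n) := hadamard * ρ * hadamard

lemma trace_mul_hadamardConj (ρ A : Op (Fin n)) :
    Matrix.trace (ρ * hadamardConj A) = Matrix.trace (hadamardConj ρ * A) := by
  rw [hadamardConj, hadamardConj, ← Matrix.mul_assoc, Matrix.trace_mul_comm]
  simp only [Matrix.mul_assoc]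

lemma hadamardConj_mul (A B : Op (Fin n)) :
    hadamardConj (A * B) = hadamardConj A * hadamardConj B := by
  calc hadamardConj (A * B) = hadamard * A * 1 * (B * hadamard) := by
        simp only [hadamardConj, Matrix.mul_assoc, Matrix.mul_one]
    _ = hadamardConj A * hadamardConj B := by
        rw [← hadamard_mul_self]
        simp only [hadamardConj, Matrix.mul_assoc]

lemma hadamardConj_one : hadamardConj (1 : Op (Fin n)) = 1 := by
  rw [hadamardConj, Matrix.mul_one, hadamard_mul_self]

lemma posSemidef_hadamardConj {A : Op (Fin n)} (hA : A.PosSemidef) :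
    (hadamardConj A).PosSemidef := by
  have := hA.conjTranspose_mul_mul_same (hadamard : Op (Fin n))
  rwa [conjTranspose_hadamard] at this

lemma IsState.hadamardConj {ρ : Op (Fin n)} (hρ : IsState ρ) : IsState (hadamardConj ρ) := by
  refine ⟨posSemidef_hadamardConj hρ.1, ?_⟩
  have h := trace_mul_hadamardConj ρ 1
  rw [hadamardConj_one, Matrix.mul_one, Matrix.mul_one] at h
  rw [← h, hρ.2]

lemma isHermitian_diagOp (f : (Fin n → ZMod 2) → ℝ) : (diagOp f).IsHermitian := by
  rw [diagOp, Matrix.isHermitian_diagonal_iff]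
  intro x
  rw [isSelfAdjoint_iff, RCLike.star_def, Complex.conj_ofReal]

lemma isHermitian_hadamardConj {A : Op (Fin n)} (hA : A.IsHermitian) :
    (hadamardConj A).IsHermitian := by
  rw [hadamardConj, Matrix.IsHermitian, Matrix.conjTranspose_mul, Matrix.conjTranspose_mul,
    conjTranspose_hadamard, hA.eq, Matrix.mul_assoc]

lemma diagOp_mul_diagOp (f g : (Fin n → ZMod 2) → ℝ) :
    diagOp f * diagOp g = diagOp fun x => f x * g x := by
  simp [diagOp, Matrix.diagonal_mul_diagonal]

lemma diagOp_one : (diagOp fun _ => 1 : Op (Fin n)) = 1 := by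
  simp [diagOp]

lemma posSemidef_diagOp {f : (Fin n → ZMod 2) → ℝ} (hf : ∀ x, 0 ≤ f x) :
    (diagOp f).PosSemidef :=
  Matrix.PosSemidef.diagonal fun x => by simpa using hf x

lemma hadamardConj_sub (A B : Op (Fin n)) :
    hadamardConj (A - B) = hadamardConj A - hadamardConj B := by
  simp only [hadamardConj, Matrix.mul_sub, Matrix.sub_mul]

/-! ## An uncertainty relation -/

/-- Shift the summation variable by `w` in the matrix entry. When the resulting factor is `-1`, the
entry vanishes. -/
lemma hadamardConj_diagOp_apply_of_add {s : (Fin n → ZMod 2) → ℝ} {w : Fin n → ZMod 2} {t : ℝ}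
    (hs : ∀ z, s (z + w) = t * s z) (x y : Fin n → ZMod 2) :
    hadamardConj (diagOp s) x y =
      ((t * sgn ((x + y) ⬝ᵥ w) : ℝ) : ℂ) * hadamardConj (diagOp s) x y := by
  have h : ∀ x y, hadamardConj (diagOp s) x y =
      ∑ z, hadamard x z * (s z : ℂ) * hadamard z y := fun x y => by
    rw [hadamardConj, Matrix.mul_apply]
    simp only [diagOp, Matrix.mul_diagonal]
  rw [h, Finset.mul_sum]
  refine Fintype.sum_equiv (Equiv.addRight w) _ _ fun z => ?_
  have hz : s z = t * s (z + w) := by rw [← hs, add_add_cancel_bits]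
  rw [hz]
  simp only [Equiv.coe_addRight, hadamard, Matrix.of_apply, ← Complex.ofReal_mul]
  congr 1
  simp only [add_dotProduct, dotProduct_add, sgn_add, dotProduct_comm w y]
  set P := (√(2 ^ Fintype.card (Fin n)))⁻¹ * (√(2 ^ Fintype.card (Fin n)))⁻¹ * sgn (x ⬝ᵥ z) *
    (t * s (z + w)) * sgn (z ⬝ᵥ y) with hP
  linear_combination -P * sgn (y ⬝ᵥ w) ^ 2 * sgn_mul_self (x ⬝ᵥ w) - P * sgn_mul_self (y ⬝ᵥ w)

/-- The Hadamard conjugate of `s` only connects strings whose sum lies in `a + dualCode C`, and `s'`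
changes sign along every such move. -/
lemma anticommute_of_sign {s s' : (Fin n → ZMod 2) → ℝ}
    {C : Submodule (ZMod 2) (Fin n → ZMod 2)} {a : Fin n → ZMod 2}
    (hs : ∀ z, ∀ w ∈ C, s (z + w) = sgn (a ⬝ᵥ w) * s z)
    (hs' : ∀ y r, r + a ∈ dualCode C → s' (y + r) = -s' y) :
    hadamardConj (diagOp s) * diagOp s' = -(diagOp s' * hadamardConj (diagOp s)) := by
  ext x y
  rw [Matrix.neg_apply, diagOp, diagOp, Matrix.mul_diagonal, Matrix.diagonal_mul]
  by_cases h : x + y + a ∈ dualCode C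
  · have hxy : s' x = -s' y := by
      rw [← hs' y (x + y) h, add_comm x y, ← add_assoc, add_self_bits, zero_add]
    rw [hxy]
    push_cast
    ring
  · have : ∃ w ∈ C, (x + y + a) ⬝ᵥ w ≠ 0 := by
      by_contra h'
      push Not at h'
      exact h h'
    obtain ⟨w, hw, hne⟩ := this
    have h1 := hadamardConj_diagOp_apply_of_add (hs · w hw) x y
    rw [← sgn_add, ← add_dotProduct, add_comm a, bit_eq_one_of_ne_zero hne, sgn_one] at h1
    have h2 : hadamardConj (diagOp s) x y = 0 := by
      push_cast at h1
      linear_combination (1 / 2 : ℂ) * h1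
    rw [diagOp] at h2
    rw [h2, zero_mul, mul_zero, neg_zero]

/-- The operator `M = A + B - 8/5` is Hermitian and, by anticommutation, `M² = 114/25 - 16/5 (A +
B)`. If both expectations were at least `4/5`, that of `M²` would be at most `(114 - 128) / 25 < 0`.
-/
lemma uncertainty {ρ A B : Op (Fin n)} (hρ : IsState ρ) (hA : A.IsHermitian)
    (hB : B.IsHermitian) (hA2 : A * A = 1) (hB2 : B * B = 1) (hAB : A * B = -(B * A))
    (hAe : 4 / 5 ≤ (Matrix.trace (ρ * A)).re) : (Matrix.trace (ρ * B)).re < 4 / 5 := by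
  by_contra! hBe
  set M : Op (Fin n) := A + B - (8 / 5 : ℂ) • 1 with hM
  have hMh : M.conjTranspose = M := by
    rw [hM, Matrix.conjTranspose_sub, Matrix.conjTranspose_add, hA.eq, hB.eq,
      Matrix.conjTranspose_smul, Matrix.conjTranspose_one]
    norm_num
  have hpos := (hρ.1.conjTranspose_mul_mul_same M).trace_nonneg
  have hsq : M * M = (114 / 25 : ℂ) • 1 - (16 / 5 : ℂ) • (A + B) := by
    simp only [hM, Matrix.sub_mul, Matrix.mul_sub, Matrix.add_mul, Matrix.mul_add, hA2, hB2, hAB,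
      Matrix.smul_mul, Matrix.mul_smul, Matrix.mul_one, Matrix.one_mul]
    module
  rw [hMh, Matrix.mul_assoc, Matrix.trace_mul_comm, Matrix.mul_assoc, hsq, Matrix.mul_sub,
    Matrix.mul_smul, Matrix.mul_smul, Matrix.mul_one, Matrix.mul_add, Matrix.trace_sub,
    Matrix.trace_smul, Matrix.trace_smul, Matrix.trace_add, hρ.2] at hpos
  have h := (Complex.le_def.1 hpos).1
  simp only [smul_eq_mul, mul_one, Complex.zero_re, Complex.sub_re, Complex.mul_re,
    Complex.add_re] at h
  norm_num at h
  linarith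

/-- Off `K` the sign is still at least `-1`. Mass `9/10` on `K` thus yields the expectation `4/5`
needed for `uncertainty`. -/
lemma sum_mul_sign_ge {κ : Type*} [Fintype κ] [DecidableEq κ] {p s : κ → ℝ}
    (hp : ∀ x, 0 ≤ p x) (hp1 : ∑ x, p x = 1) (hs : ∀ x, s x * s x = 1) {K : Finset κ}
    (hK : ∀ x ∈ K, s x = 1) : 2 * ∑ x ∈ K, p x - 1 ≤ ∑ x, p x * s x := by
  have h1 : ∀ x, -1 ≤ s x := fun x => by nlinarith [hs x]
  have h2 : 2 * ∑ x ∈ K, p x ≤ ∑ x, p x * (s x + 1) := by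
    calc 2 * ∑ x ∈ K, p x = ∑ x ∈ K, p x * (s x + 1) := by
          rw [Finset.mul_sum]
          exact Finset.sum_congr rfl fun x hx => by rw [hK x hx]; ring
      _ ≤ ∑ x, p x * (s x + 1) :=
          Finset.sum_le_sum_of_subset_of_nonneg (Finset.subset_univ _) fun x _ _ =>
            mul_nonneg (hp x) (by linarith [h1 x])
  simp only [mul_add, mul_one, Finset.sum_add_distrib, hp1] at h2
  linarith

/-! ## Reduced states of circuit outputs -/

section Output

variable {a : ℕ}

lemma prob_outputState (C : Circuit (Fin n ⊕ Fin a)) (x : Fin n → ZMod 2) :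
    prob C.outputState x = marginal C.outputVec x := by
  rw [prob, Circuit.outputState, Matrix.of_apply, Complex.re_sum, marginal]
  refine Finset.sum_congr rfl fun z _ => ?_
  rw [RCLike.star_def, Complex.mul_conj']
  norm_cast

lemma hadamard_elim (x y : Fin n → ZMod 2) (z w : Fin a → ZMod 2) :
    (hadamard : Op (Fin n ⊕ Fin a)) (Sum.elim x z) (Sum.elim y w) =
      hadamard x y * hadamard z w := by
  simp only [hadamard, Matrix.of_apply, ← Complex.ofReal_mul]
  congr 1
  rw [Fintype.card_sum, pow_add, Real.sqrt_mul (by positivity), mul_inv,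
    show Sum.elim x z ⬝ᵥ Sum.elim y w = x ⬝ᵥ y + z ⬝ᵥ w by simp [dotProduct], sgn_add]
  ring

/-- Hadamards on the ancillas are unitary and disappear when the ancillas are summed over, so
transforming all qubits or only the first `n` gives the same marginal. -/
lemma prob_hadamardConj_outputState (C : Circuit (Fin n ⊕ Fin a)) (x : Fin n → ZMod 2) :
    prob (hadamardConj C.outputState) x = marginal (hadamard.mulVec C.outputVec) x := by
  set ψ := C.outputVec with hψ
  set φ : (Fin a → ZMod 2) → ℂ := fun w => ∑ y, hadamard x y * ψ (Sum.elim y w) with hφ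
  have h1 : ∀ z, hadamard.mulVec ψ (Sum.elim x z) = hadamard.mulVec φ z := by
    intro z
    rw [Matrix.mulVec, dotProduct,
      ← (Equiv.sumArrowEquivProdArrow (Fin n) (Fin a) (ZMod 2)).symm.sum_comp,
      Fintype.sum_prod_type_right, Matrix.mulVec, dotProduct]
    refine Finset.sum_congr rfl fun w _ => ?_
    rw [hφ, Finset.mul_sum]
    refine Finset.sum_congr rfl fun y _ => ?_
    have : (Equiv.sumArrowEquivProdArrow (Fin n) (Fin a) (ZMod 2)).symm (y, w) = Sum.elim y w :=
      rfl
    rw [this, hadamard_elim]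
    ring
  have h2 : marginal (hadamard.mulVec ψ) x = ∑ w, ‖φ w‖ ^ 2 := by
    rw [marginal]
    simp only [h1]
    exact sum_norm_sq_mulVec (by rw [conjTranspose_hadamard, hadamard_mul_self]) φ
  have h3 : hadamardConj C.outputState x x = ((∑ w, ‖φ w‖ ^ 2 : ℝ) : ℂ) := by
    have hsym : ∀ y, (hadamard : Op (Fin n)) y x = star (hadamard x y) := fun y => by
      rw [← Matrix.conjTranspose_apply, conjTranspose_hadamard]
    push_cast
    simp only [← Complex.mul_conj', hadamardConj, Matrix.mul_apply, Circuit.outputState,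
      Matrix.of_apply, hsym, ← hψ, hφ, map_sum, map_mul, Finset.sum_mul, Finset.mul_sum,
      RCLike.star_def]
    rw [Finset.sum_congr rfl fun _ _ => Finset.sum_comm, Finset.sum_comm]
    refine Finset.sum_congr rfl fun w _ => ?_
    refine Finset.sum_congr rfl fun y _ => Finset.sum_congr rfl fun y' _ => ?_
    ring
  rw [h2, prob, h3, Complex.ofReal_re]

lemma sq_dist_le_of_spread_prob (C : Circuit (Fin n ⊕ Fin a)) {S T : Finset (Fin n → ZMod 2)}
    {D μ : ℝ} (hD : 0 < D) (hμ : 0 < μ) (hdist : ∀ x ∈ S, ∀ y ∈ T, D ≤ hammingDist x y)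
    (hS : μ ≤ ∑ x ∈ S, prob C.outputState x) (hT : μ ≤ ∑ x ∈ T, prob C.outputState x) :
    μ / 2 * D ^ 2 ≤ n * 4 ^ C.depth := by
  simp only [prob_outputState] at hS hT
  refine sq_dist_le_of_spread C C.conjTranspose_toOp_mul_self (fun i => ?_) rfl hD hμ hdist hS hT
  have h := C.conj_mem_supportedOn (pauliZ_single_mem_supportedOn i)
  simpa using h

lemma sq_dist_le_of_spread_prob_hadamardConj (C : Circuit (Fin n ⊕ Fin a))
    {S T : Finset (Fin n → ZMod 2)} {D μ : ℝ} (hD : 0 < D) (hμ : 0 < μ)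
    (hdist : ∀ x ∈ S, ∀ y ∈ T, D ≤ hammingDist x y)
    (hS : μ ≤ ∑ x ∈ S, prob (hadamardConj C.outputState) x)
    (hT : μ ≤ ∑ x ∈ T, prob (hadamardConj C.outputState) x) :
    μ / 2 * D ^ 2 ≤ n * 4 ^ C.depth := by
  simp only [prob_hadamardConj_outputState] at hS hT
  refine sq_dist_le_of_spread C (U := hadamard * C.toOp) ?_ (fun i => ?_) ?_ hD hμ hdist hS hT
  · rw [Matrix.conjTranspose_mul, conjTranspose_hadamard, Matrix.mul_assoc,
      ← Matrix.mul_assoc hadamard, hadamard_mul_self, Matrix.one_mul,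
      C.conjTranspose_toOp_mul_self]
  · have h := hadamard_conj_mem_supportedOn
      (C.conj_mem_supportedOn (pauliZ_single_mem_supportedOn i))
    rw [Matrix.conjTranspose_mul, conjTranspose_hadamard]
    simpa [Matrix.mul_assoc] using h
  · rw [Circuit.outputVec, Matrix.mulVec_mulVec]

end Output

end States

/-! ## The code Hamiltonian -/

section Hamiltonian

variable {n m : ℕ}

/-- The fraction of violated parity checks. -/
def violation (H : Matrix (Fin m) (Fin n) (ZMod 2)) (y : Fin n → ZMod 2) : ℝ :=
  (hammingNorm (H.mulVec y) : ℝ) / m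

lemma violation_nonneg (H : Matrix (Fin m) (Fin n) (ZMod 2)) (y : Fin n → ZMod 2) :
    0 ≤ violation H y := by
  unfold violation
  positivity

lemma violation_le_one (H : Matrix (Fin m) (Fin n) (ZMod 2)) (y : Fin n → ZMod 2) :
    violation H y ≤ 1 := by
  refine div_le_one_of_le₀ ?_ (Nat.cast_nonneg _)
  exact_mod_cast (hammingNorm_le_card_fintype (x := H.mulVec y)).trans_eq (Fintype.card_fin m)

lemma violation_eq_sum (H : Matrix (Fin m) (Fin n) (ZMod 2)) (y : Fin n → ZMod 2) :
    violation H y = (1 / m : ℝ) * ∑ i, (1 - sgn (H i ⬝ᵥ y)) / 2 := by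
  simp only [one_sub_sgn_div_two, Finset.sum_boole, violation, hammingNorm]
  rw [div_eq_inv_mul, one_div]
  rfl

lemma average_pauliZ (H : Matrix (Fin m) (Fin n) (ZMod 2)) :
    (1 / (m : ℂ)) • ∑ i, (1 / 2 : ℂ) • (1 - pauliZ (H i)) = diagOp (violation H) := by
  ext x y
  simp only [Matrix.smul_apply, Matrix.sum_apply, Matrix.sub_apply, pauliZ_eq_diagOp, diagOp]
  by_cases hxy : x = y
  · subst hxy
    simp only [Matrix.diagonal_apply_eq, Matrix.one_apply_eq, smul_eq_mul, violation_eq_sum]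
    push_cast
    congr 1
    exact Finset.sum_congr rfl fun i _ => by ring
  · simp [hxy]

lemma average_pauliX (H : Matrix (Fin m) (Fin n) (ZMod 2)) :
    (1 / (m : ℂ)) • ∑ i, (1 / 2 : ℂ) • (1 - pauliX (H i)) =
      hadamardConj (diagOp (violation H)) := by
  rw [← average_pauliZ, hadamardConj]
  simp only [pauliX_eq_conj, Matrix.mul_smul, Matrix.smul_mul, Finset.mul_sum, Finset.sum_mul,
    Matrix.mul_sub, Matrix.sub_mul, Matrix.mul_one, hadamard_mul_self]

lemma CSSCode.hamiltonian_eq {mX mZ : ℕ} (Q : CSSCode n mX mZ) :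
    Q.hamiltonian =
      (1 / 2 : ℂ) • (hadamardConj (diagOp (violation Q.HX)) + diagOp (violation Q.HZ)) := by
  rw [CSSCode.hamiltonian, average_pauliX, average_pauliZ]

lemma CSSCode.energy_eq {mX mZ : ℕ} (Q : CSSCode n mX mZ) (ρ : Op (Fin n)) :
    (Matrix.trace (ρ * Q.hamiltonian)).re =
      (∑ y, prob (hadamardConj ρ) y * violation Q.HX y + ∑ y, prob ρ y * violation Q.HZ y) / 2 := by
  rw [Q.hamiltonian_eq, Matrix.mul_smul, Matrix.trace_smul, Matrix.mul_add, Matrix.trace_add,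
    trace_mul_hadamardConj, ← trace_mul_diagOp_re, ← trace_mul_diagOp_re, smul_eq_mul,
    Complex.mul_re, Complex.add_re]
  norm_num
  ring

lemma half_nonneg : (0 : ℂ) ≤ 1 / 2 := by
  simp

lemma CSSCode.hamiltonian_posSemidef {mX mZ : ℕ} (Q : CSSCode n mX mZ) :
    Q.hamiltonian.PosSemidef := by
  rw [Q.hamiltonian_eq]
  exact ((posSemidef_hadamardConj (posSemidef_diagOp (violation_nonneg _))).add
    (posSemidef_diagOp (violation_nonneg _))).smul half_nonneg

lemma CSSCode.one_sub_hamiltonian_posSemidef {mX mZ : ℕ} (Q : CSSCode n mX mZ) :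
    (1 - Q.hamiltonian).PosSemidef := by
  have hd : ∀ {m : ℕ} (H : Matrix (Fin m) (Fin n) (ZMod 2)),
      (1 - diagOp (violation H)).PosSemidef := fun H => by
    have : 1 - diagOp (violation H) = diagOp fun y => 1 - violation H y := by
      ext x y
      by_cases hxy : x = y <;> simp [diagOp, hxy]
    rw [this]
    exact posSemidef_diagOp fun y => sub_nonneg.2 (violation_le_one H y)
  have hEq : 1 - Q.hamiltonian = (1 / 2 : ℂ) • (hadamardConj (1 - diagOp (violation Q.HX)) +
      (1 - diagOp (violation Q.HZ))) := by
    rw [Q.hamiltonian_eq, hadamardConj_sub, hadamardConj_one]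
    module
  rw [hEq]
  exact ((posSemidef_hadamardConj (hd _)).add (hd _)).smul half_nonneg

/-! ## Locality -/

lemma isLocalHamiltonian_sum {κ : Type*} [Fintype κ] {ℓ : ℕ} (S : κ → Finset (Fin n))
    (h : (k : κ) → Op (S k)) (hS : ∀ k, (S k).card ≤ ℓ) (hh : ∀ k, (h k).IsHermitian) :
    IsLocalHamiltonian ℓ (∑ k, localOp (S k) (h k)) := by
  let e := Fintype.equivFin κ
  exact ⟨Fintype.card κ, fun i => S (e.symm i), fun i => h (e.symm i), fun i => hS _,
    fun i => hh _, (e.symm.sum_comp fun k => localOp (S k) (h k)).symm⟩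

/-! ### Pauli operators as local operators on their supports -/

section Support

variable {ι : Type} [Fintype ι] [DecidableEq ι]

/-- The support of a vector. -/
def bitSupport (a : ι → ZMod 2) : Finset (ι) := Finset.univ.filter fun i => a i ≠ 0

lemma localOp_pauliX (a : ι → ZMod 2) :
    localOp (bitSupport a) (pauliX fun i => a i) = pauliX a := by
  have ha : ∀ i, i ∉ bitSupport a → a i = 0 := fun i hi => by simpa [bitSupport] using hi
  ext x y
  simp only [localOp, pauliX, Matrix.of_apply]
  rw [← ite_and]
  refine if_congr ⟨fun h => ?_, fun h => ?_⟩ rfl rfl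
  · funext i
    by_cases hi : i ∈ bitSupport a
    · exact congrFun h.2 ⟨i, hi⟩
    · rw [h.1 i hi, Pi.add_apply, ha i hi, add_zero]
  · subst h
    exact ⟨fun i hi => by rw [Pi.add_apply, ha i hi, add_zero], rfl⟩

lemma localOp_pauliZ (a : ι → ZMod 2) :
    localOp (bitSupport a) (pauliZ fun i => a i) = pauliZ a := by
  have ha : ∀ i, i ∉ bitSupport a → a i = 0 := fun i hi => by simpa [bitSupport] using hi
  have hdot : ∀ y : ι → ZMod 2,
      ((fun i : bitSupport a => a i) ⬝ᵥ fun i : bitSupport a => y i) = a ⬝ᵥ y := fun y => by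
    simp only [dotProduct]
    rw [Finset.sum_coe_sort (bitSupport a) fun i => a i * y i]
    exact Finset.sum_subset (Finset.subset_univ _) fun i _ hi => by rw [ha i hi, zero_mul]
  ext x y
  simp only [localOp, pauliZ, Matrix.of_apply, Matrix.diagonal_apply]
  rw [← ite_and, hdot]
  refine if_congr ⟨fun h => ?_, fun h => ?_⟩ rfl rfl
  · funext i
    by_cases hi : i ∈ bitSupport a
    · exact congrFun h.2 ⟨i, hi⟩
    · exact h.1 i hi
  · subst h
    exact ⟨fun _ _ => rfl, rfl⟩

end Support

lemma localOp_smul_one_sub (S : Finset (Fin n)) (c : ℂ) (u : Op S) :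
    localOp S (c • (1 - u)) = c • (1 - localOp S u) := by
  rw [← localOp_one S]
  ext x y
  simp only [localOp, Matrix.of_apply, Matrix.smul_apply, Matrix.sub_apply]
  split_ifs <;> simp

lemma isHermitian_pauliX {ι : Type} [Fintype ι] [DecidableEq ι] (a : ι → ZMod 2) :
    (pauliX a).IsHermitian := by
  ext x y
  simp only [Matrix.conjTranspose_apply, pauliX, Matrix.of_apply, apply_ite star, star_one,
    star_zero]
  exact if_congr ⟨fun h => by rw [h, add_add_cancel_bits], fun h => by rw [h, add_add_cancel_bits]⟩
    rfl rfl

lemma isHermitian_pauliZ {ι : Type} [Fintype ι] [DecidableEq ι] (a : ι → ZMod 2) :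
    (pauliZ a).IsHermitian := by
  rw [pauliZ_eq_diagOp, diagOp, Matrix.isHermitian_diagonal_iff]
  intro x
  rw [isSelfAdjoint_iff, RCLike.star_def, Complex.conj_ofReal]

lemma CSSCode.isLocalHamiltonian_hamiltonian {mX mZ : ℕ} (Q : CSSCode n mX mZ) {ℓ : ℕ}
    (hQ : Q.HasLocality ℓ) : IsLocalHamiltonian ℓ Q.hamiltonian := by
  have hsa : ∀ (k : ℕ), IsSelfAdjoint (1 / 2 * (1 / (k : ℂ)) * (1 / 2)) := fun k => by
    rw [isSelfAdjoint_iff]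
    simp
  let S : Fin mX ⊕ Fin mZ → Finset (Fin n) :=
    Sum.elim (fun i => bitSupport (Q.HX i)) fun i => bitSupport (Q.HZ i)
  let hX : (i : Fin mX) → Op (bitSupport (Q.HX i)) := fun i =>
    (1 / 2 * (1 / (mX : ℂ)) * (1 / 2)) • (1 - pauliX fun j : bitSupport (Q.HX i) => Q.HX i j)
  let hZ : (i : Fin mZ) → Op (bitSupport (Q.HZ i)) := fun i =>
    (1 / 2 * (1 / (mZ : ℂ)) * (1 / 2)) • (1 - pauliZ fun j : bitSupport (Q.HZ i) => Q.HZ i j)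
  let h : (k : Fin mX ⊕ Fin mZ) → Op (S k) := Sum.rec (motive := fun k => Op (S k)) hX hZ
  have hEq : Q.hamiltonian = ∑ k, localOp (S k) (h k) := by
    rw [Fintype.sum_sum_type]
    change _ = ∑ i, localOp (bitSupport (Q.HX i)) (hX i) +
      ∑ i, localOp (bitSupport (Q.HZ i)) (hZ i)
    simp only [hX, hZ, localOp_smul_one_sub, localOp_pauliX, localOp_pauliZ,
      CSSCode.hamiltonian, smul_add, Finset.smul_sum, smul_smul, mul_assoc]
  rw [hEq]
  refine isLocalHamiltonian_sum S h ?_ ?_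
  · rintro (i | i)
    · exact hQ.1 i
    · exact hQ.2.2.1 i
  · rintro (i | i)
    · exact (Matrix.isHermitian_one.sub (isHermitian_pauliX _)).smul (hsa _)
    · exact (Matrix.isHermitian_one.sub (isHermitian_pauliZ _)).smul (hsa _)

end Hamiltonian

/-! ## Coset weights and logical operators -/

section Codes

variable {n mX mZ : ℕ}

lemma cosetWeight_le {N : Submodule (ZMod 2) (Fin n → ZMod 2)} (y : Fin n → ZMod 2)
    {r : Fin n → ZMod 2} (hr : r ∈ N) : cosetWeight N y ≤ hammingNorm (y + r) :=
  ciInf_le (OrderBot.bddBelow _) (⟨r, hr⟩ : N)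

lemma cosetWeight_le_hammingNorm (N : Submodule (ZMod 2) (Fin n → ZMod 2)) (y : Fin n → ZMod 2) :
    cosetWeight N y ≤ hammingNorm y := by
  simpa using cosetWeight_le y N.zero_mem

lemma exists_hammingNorm_eq_cosetWeight (N : Submodule (ZMod 2) (Fin n → ZMod 2))
    (y : Fin n → ZMod 2) : ∃ r ∈ N, hammingNorm (y + r) = cosetWeight N y := by
  obtain ⟨r, hr⟩ := ciInf_mem fun r : N => hammingNorm (y + (r : Fin n → ZMod 2))
  exact ⟨r, r.2, hr⟩

lemma hammingDist_eq_hammingNorm_add {m : ℕ} (x y : Fin m → ZMod 2) :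
    hammingDist x y = hammingNorm (x + y) := by
  rw [hammingDist_eq_hammingNorm]
  congr 1
  funext i
  simp [CharTwo.neg_eq]

lemma hammingNorm_add_le {m : ℕ} (x y : Fin m → ZMod 2) :
    hammingNorm (x + y) ≤ hammingNorm x + hammingNorm y := by
  rw [← hammingDist_eq_hammingNorm_add, ← hammingDist_zero_right x, ← hammingDist_zero_left]
  exact hammingDist_triangle x 0 y

lemma cosetWeight_add_le (N : Submodule (ZMod 2) (Fin n → ZMod 2)) (x y : Fin n → ZMod 2) :
    cosetWeight N (x + y) ≤ cosetWeight N x + cosetWeight N y := by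
  obtain ⟨r, hr, hxr⟩ := exists_hammingNorm_eq_cosetWeight N x
  obtain ⟨s, hs, hys⟩ := exists_hammingNorm_eq_cosetWeight N y
  refine (cosetWeight_le (x + y) (N.add_mem hr hs)).trans ?_
  rw [← hxr, ← hys, add_add_add_comm]
  exact hammingNorm_add_le _ _

lemma cosetWeight_zero (N : Submodule (ZMod 2) (Fin n → ZMod 2)) : cosetWeight N 0 = 0 := by
  have := cosetWeight_le_hammingNorm N 0
  rwa [hammingNorm_zero, Nat.le_zero] at this

lemma mem_of_cosetWeight_eq_zero {N : Submodule (ZMod 2) (Fin n → ZMod 2)} {y : Fin n → ZMod 2}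
    (h : cosetWeight N y = 0) : y ∈ N := by
  obtain ⟨r, hr, hyr⟩ := exists_hammingNorm_eq_cosetWeight N y
  rw [h, hammingNorm_eq_zero] at hyr
  rw [← add_add_cancel_bits y r, hyr, zero_add]
  exact hr

namespace CSSCode

variable (Q : CSSCode n mX mZ)

lemma mem_CX_iff {y : Fin n → ZMod 2} : y ∈ Q.CX ↔ Q.HX.mulVec y = 0 := by
  rw [CX, LinearMap.mem_ker, Matrix.mulVecLin_apply]

lemma mem_CZ_iff {y : Fin n → ZMod 2} : y ∈ Q.CZ ↔ Q.HZ.mulVec y = 0 := by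
  rw [CZ, LinearMap.mem_ker, Matrix.mulVecLin_apply]

lemma dualCode_CX_le_CZ : dualCode Q.CX ≤ Q.CZ := Q.dual_le

/-- The rows of `HX` lie in `dualCode CX ≤ CZ`, so every element of `dualCode CZ` is orthogonal to
them. -/
lemma dualCode_CZ_le_CX : dualCode Q.CZ ≤ Q.CX := by
  intro x hx
  rw [mem_CX_iff]
  funext i
  have hrow : Q.HX i ∈ dualCode Q.CX := fun y hy => congrFun (Q.mem_CX_iff.1 hy) i
  have := hx _ (Q.dualCode_CX_le_CZ hrow)
  rwa [dotProduct_comm] at this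

lemma exists_logical_pair (h : 0 < Q.dim) : ∃ a ∈ Q.CZ, ∃ b ∈ Q.CX, a ⬝ᵥ b = 1 := by
  have : ¬ Q.CZ ≤ dualCode Q.CX := fun hle => by
    have := Submodule.finrank_mono hle
    rw [dim] at h
    omega
  obtain ⟨a, ha, ha'⟩ := SetLike.not_le_iff_exists.1 this
  have : ∃ b ∈ Q.CX, a ⬝ᵥ b ≠ 0 := by
    by_contra! h'
    exact ha' h'
  obtain ⟨b, hb, hab⟩ := this
  exact ⟨a, ha, b, hb, bit_eq_one_of_ne_zero hab⟩

lemma pos_of_dim_pos (h : 0 < Q.dim) : 0 < n := by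
  obtain ⟨a, -, b, -, hab⟩ := Q.exists_logical_pair h
  rcases Nat.eq_zero_or_pos n with rfl | hn
  · simp at hab
  · exact hn

lemma dist_le_cosetWeight_Z {y : Fin n → ZMod 2} (hy : y ∈ Q.CZ) (hy' : y ∉ dualCode Q.CX) :
    Q.dist ≤ cosetWeight (dualCode Q.CX) y := by
  obtain ⟨r, hr, h⟩ := exists_hammingNorm_eq_cosetWeight (dualCode Q.CX) y
  exact Nat.sInf_le ⟨y + r, Or.inl ⟨Q.CZ.add_mem hy (Q.dualCode_CX_le_CZ hr), fun h' =>
    hy' (((dualCode Q.CX).add_mem_iff_left hr).1 h')⟩, h⟩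

lemma dist_le_cosetWeight_X {y : Fin n → ZMod 2} (hy : y ∈ Q.CX) (hy' : y ∉ dualCode Q.CZ) :
    Q.dist ≤ cosetWeight (dualCode Q.CZ) y := by
  obtain ⟨r, hr, h⟩ := exists_hammingNorm_eq_cosetWeight (dualCode Q.CZ) y
  exact Nat.sInf_le ⟨y + r, Or.inr ⟨Q.CX.add_mem hy (Q.dualCode_CZ_le_CX hr), fun h' =>
    hy' (((dualCode Q.CZ).add_mem_iff_left hr).1 h')⟩, h⟩

end CSSCode

/-! ## Clusters -/

/-- Take a smallest union of classes of mass at least `1/50`. Removing one class leaves less than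
`1/50`, so without a heavy class the union has mass below `1/50 + 9/10`, and its complement in `G`
has more than `19/20 - 46/50 = 3/100`. -/
lemma exists_heavy_class_or_spread {κ : Type*} [Fintype κ] [DecidableEq κ] {p : κ → ℝ}
    (G : Finset κ) (near : κ → κ → Prop)
    [∀ x y, Decidable (near x y)] (hrefl : ∀ x, near x x) (hsymm : ∀ x y, near x y → near y x)
    (htrans : ∀ x ∈ G, ∀ y ∈ G, ∀ z ∈ G, near x y → near y z → near x z)
    (hG : 19 / 20 ≤ ∑ x ∈ G, p x) :
    (∃ x ∈ G, 9 / 10 ≤ ∑ y ∈ G.filter (near x), p y) ∨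
      ∃ S ⊆ G, ∃ T ⊆ G, 1 / 50 ≤ ∑ x ∈ S, p x ∧ 1 / 50 ≤ ∑ x ∈ T, p x ∧
        ∀ x ∈ S, ∀ y ∈ T, ¬ near x y := by
  by_cases hheavy : ∃ x ∈ G, 9 / 10 ≤ ∑ y ∈ G.filter (near x), p y
  · exact Or.inl hheavy
  right
  push Not at hheavy
  classical
  let P : Finset (Finset κ) := G.powerset.filter fun S =>
    (∀ x ∈ S, ∀ y ∈ G, near x y → y ∈ S) ∧ 1 / 50 ≤ ∑ x ∈ S, p x
  have hP : P.Nonempty :=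
    ⟨G, by simp only [P, Finset.mem_filter, Finset.mem_powerset, subset_refl, true_and]
           exact ⟨fun _ _ y hy _ => hy, by linarith⟩⟩
  obtain ⟨S, hSP, hmin⟩ := P.exists_min_image Finset.card hP
  simp only [P, Finset.mem_filter, Finset.mem_powerset] at hSP hmin
  obtain ⟨hSG, hsat, hS⟩ := hSP
  obtain ⟨x, hx⟩ : S.Nonempty := by
    by_contra h
    rw [Finset.not_nonempty_iff_eq_empty.1 h, Finset.sum_empty] at hS
    norm_num at hS
  set K := G.filter (near x) with hK
  have hKS : K ⊆ S := fun y hy => by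
    rw [hK, Finset.mem_filter] at hy
    exact hsat x hx y hy.1 hy.2
  have hxK : x ∈ K := Finset.mem_filter.2 ⟨hSG hx, hrefl x⟩
  have hsmall : ∑ y ∈ S \ K, p y < 1 / 50 := by
    by_contra! hge
    have hcard := hmin (S \ K) ⟨Finset.sdiff_subset.trans hSG, fun y hy z hz hyz => ?_, hge⟩
    · have : (S \ K).card < S.card := Finset.card_lt_card
        ((Finset.ssubset_iff_of_subset Finset.sdiff_subset).2 ⟨x, hx, by simp [hxK]⟩)
      omega
    · rw [Finset.mem_sdiff] at hy ⊢
      refine ⟨hsat y hy.1 z hz hyz, fun hzK => hy.2 ?_⟩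
      rw [hK, Finset.mem_filter] at hzK ⊢
      exact ⟨hSG hy.1, htrans x (hSG hx) z hz y (hSG hy.1) hzK.2 (hsymm y z hyz)⟩
  have h1 := Finset.sum_sdiff (f := p) hKS
  have h2 := Finset.sum_sdiff (f := p) hSG
  have h3 := hheavy x (hSG hx)
  refine ⟨S, hSG, G \ S, Finset.sdiff_subset, hS, by linarith, fun y hy z hz hyz => ?_⟩
  rw [Finset.mem_sdiff] at hz
  exact hz.2 (hsat y hy z hz.1 hyz)

/-- On words of small syndrome, "coset weight of the sum at most `R`" is transitive: the triangle
inequality gives at most `2R < D`, and the dichotomy improves this to `R`. Inside one class, equal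
syndromes force a difference in `N`, since an element of the kernel outside `N` has coset weight
above `R`. -/
lemma exists_spread_or_concentrated {m : ℕ} (H : Matrix (Fin m) (Fin n) (ZMod 2))
    (N : Submodule (ZMod 2) (Fin n → ZMod 2)) {p : (Fin n → ZMod 2) → ℝ} (hp : ∀ x, 0 ≤ p x)
    (hp1 : ∑ x, p x = 1) {η R D : ℝ} (hη : 0 < η) (hR : 0 ≤ R)
    (hcl : ∀ y, (hammingNorm (H.mulVec y) : ℝ) ≤ 2 * η * m →
      (cosetWeight N y : ℝ) ≤ R ∨ D ≤ (cosetWeight N y : ℝ))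
    (hRD : 2 * R < D) (hd : ∀ y, H.mulVec y = 0 → y ∉ N → R < cosetWeight N y)
    (hE : ∑ y, p y * violation H y ≤ η / 500) :
    (∃ S T : Finset (Fin n → ZMod 2), 1 / 50 ≤ ∑ x ∈ S, p x ∧ 1 / 50 ≤ ∑ x ∈ T, p x ∧
      ∀ x ∈ S, ∀ y ∈ T, D ≤ hammingDist x y) ∨
    ∃ K : Finset (Fin n → ZMod 2), 9 / 10 ≤ ∑ x ∈ K, p x ∧
      ∀ y ∈ K, ∀ y' ∈ K, H.mulVec y = H.mulVec y' → y + y' ∈ N := by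
  classical
  set G : Finset (Fin n → ZMod 2) :=
    Finset.univ.filter fun y => (hammingNorm (H.mulVec y) : ℝ) ≤ η * m with hG
  have hmemG : ∀ y, y ∈ G ↔ (hammingNorm (H.mulVec y) : ℝ) ≤ η * m := fun y => by simp [hG]
  have hmarkov : 19 / 20 ≤ ∑ x ∈ G, p x := by
    have h1 : (∑ y ∈ Gᶜ, p y) * η ≤ ∑ y, p y * violation H y := by
      rw [Finset.sum_mul]
      calc ∑ y ∈ Gᶜ, p y * η ≤ ∑ y ∈ Gᶜ, p y * violation H y := by
            refine Finset.sum_le_sum fun y hy => mul_le_mul_of_nonneg_left ?_ (hp y)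
            rw [Finset.mem_compl, hmemG, not_le] at hy
            -- With no checks the syndrome is zero and `hy` fails, so the division by `m` is
            -- legitimate.
            have hm : 0 < m := by
              rcases Nat.eq_zero_or_pos m with rfl | hm
              · have h0 : H.mulVec y = 0 := Subsingleton.elim _ _
                simp [h0] at hy
              · exact hm
            rw [violation, le_div_iff₀ (by exact_mod_cast hm)]
            exact hy.le
        _ ≤ ∑ y, p y * violation H y :=
            Finset.sum_le_sum_of_subset_of_nonneg (Finset.subset_univ _) fun y _ _ =>
              mul_nonneg (hp y) (violation_nonneg H y)
    have h2 := Finset.sum_add_sum_compl G p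
    have h3 : ∑ y ∈ Gᶜ, p y ≤ 1 / 500 := by
      have : (∑ y ∈ Gᶜ, p y) * η ≤ 1 / 500 * η := by linarith
      exact le_of_mul_le_mul_right this hη
    linarith
  have hdich : ∀ x ∈ G, ∀ y ∈ G, (cosetWeight N (x + y) : ℝ) ≤ R ∨
      D ≤ (cosetWeight N (x + y) : ℝ) := fun x hx y hy => hcl _ <| by
    have h1 : (hammingNorm (H.mulVec (x + y)) : ℝ) ≤
        hammingNorm (H.mulVec x) + hammingNorm (H.mulVec y) := by
      rw [Matrix.mulVec_add]
      exact_mod_cast hammingNorm_add_le _ _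
    rw [hmemG] at hx hy
    linarith
  have htri : ∀ x y z, (cosetWeight N (x + z) : ℝ) ≤
      cosetWeight N (x + y) + cosetWeight N (y + z) := fun x y z => by
    have h := cosetWeight_add_le N (x + y) (y + z)
    rw [← add_assoc, add_add_cancel_bits] at h
    exact_mod_cast h
  have htrans : ∀ x ∈ G, ∀ y ∈ G, ∀ z ∈ G, (cosetWeight N (x + y) : ℝ) ≤ R →
      (cosetWeight N (y + z) : ℝ) ≤ R → (cosetWeight N (x + z) : ℝ) ≤ R :=
    fun x hx y _ z hz hxy hyz => (hdich x hx z hz).resolve_right fun h => by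
      linarith [htri x y z]
  have hsymm : ∀ x y, (cosetWeight N (x + y) : ℝ) ≤ R → (cosetWeight N (y + x) : ℝ) ≤ R :=
    fun x y h => by rwa [add_comm]
  rcases exists_heavy_class_or_spread G (fun x y => (cosetWeight N (x + y) : ℝ) ≤ R)
    (fun x => by rw [add_self_bits, cosetWeight_zero]; simpa using hR) hsymm htrans hmarkov with
    ⟨x, hx, hheavy⟩ | ⟨S, hSG, T, hTG, hS, hT, hfar⟩
  · refine Or.inr ⟨_, hheavy, fun y hy y' hy' hyy => ?_⟩
    rw [Finset.mem_filter] at hy hy'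
    by_contra hN
    have h0 : H.mulVec (y + y') = 0 := by rw [Matrix.mulVec_add, hyy, add_self_bits]
    exact (hd _ h0 hN).not_ge (htrans y hy.1 x hx y' hy'.1 (hsymm _ _ hy.2) hy'.2)
  · refine Or.inl ⟨S, T, hS, hT, fun x hx y hy => ?_⟩
    refine ((hdich x (hSG hx) y (hTG hy)).resolve_left (hfar x hx y hy)).trans ?_
    rw [hammingDist_eq_hammingNorm_add]
    exact_mod_cast cosetWeight_le_hammingNorm N (x + y)

/-- A decoder `g` assigns to each syndrome a reference word, and `s y` is the logical sign of `y + g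
(H y)`. On `K` this word lies in `N`, which `b` annihilates; a shift by a kernel element leaves the
syndrome, hence the correction, unchanged. -/
lemma exists_decoding_sign {m : ℕ} (H : Matrix (Fin m) (Fin n) (ZMod 2))
    {N : Submodule (ZMod 2) (Fin n → ZMod 2)} {K : Finset (Fin n → ZMod 2)}
    (hK : ∀ y ∈ K, ∀ y' ∈ K, H.mulVec y = H.mulVec y' → y + y' ∈ N) {b : Fin n → ZMod 2}
    (hb : ∀ r ∈ N, b ⬝ᵥ r = 0) :
    ∃ s : (Fin n → ZMod 2) → ℝ, (∀ y, s y * s y = 1) ∧ (∀ y ∈ K, s y = 1) ∧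
      ∀ y w, H.mulVec w = 0 → s (y + w) = sgn (b ⬝ᵥ w) * s y := by
  have hg : ∀ σ : Fin m → ZMod 2, ∃ g : Fin n → ZMod 2,
      ∀ y ∈ K, H.mulVec y = σ → y + g ∈ N := by
    intro σ
    by_cases h : ∃ g ∈ K, H.mulVec g = σ
    · obtain ⟨g, hgK, hgσ⟩ := h
      exact ⟨g, fun y hy hyσ => hK y hy g hgK (hyσ.trans hgσ.symm)⟩
    -- For a syndrome not occurring in `K` any correction works.
    · exact ⟨0, fun y hy hyσ => absurd ⟨y, hy, hyσ⟩ h⟩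
  choose g hg using hg
  refine ⟨fun y => sgn (b ⬝ᵥ (y + g (H.mulVec y))), fun y => sgn_mul_self _, fun y hy => ?_,
    fun y w hw => ?_⟩
  · change sgn _ = 1
    rw [hb _ (hg _ y hy rfl), sgn_zero]
  · change sgn _ = sgn _ * sgn _
    rw [Matrix.mulVec_add, hw, add_zero, ← sgn_add, ← dotProduct_add]
    congr 2
    abel

/-! ## The depth lower bound -/

/-- For logical `a`, `b` with `a ⬝ᵥ b = 1`, the two decoded signs give one involution diagonal in
each basis; they anticommute, so `uncertainty` applies. -/
lemma CSSCode.not_both_concentrated (Q : CSSCode n mX mZ) (hdim : 0 < Q.dim) {ρ : Op (Fin n)}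
    (hρ : IsState ρ) {KX KZ : Finset (Fin n → ZMod 2)}
    (hKX : ∀ y ∈ KX, ∀ y' ∈ KX, Q.HX.mulVec y = Q.HX.mulVec y' → y + y' ∈ dualCode Q.CZ)
    (hKZ : ∀ y ∈ KZ, ∀ y' ∈ KZ, Q.HZ.mulVec y = Q.HZ.mulVec y' → y + y' ∈ dualCode Q.CX)
    (hX : 9 / 10 ≤ ∑ x ∈ KX, prob (NLTS.hadamardConj ρ) x) :
    ∑ x ∈ KZ, prob ρ x < 9 / 10 := by
  by_contra! hZ
  obtain ⟨a, ha, b, hb, hab⟩ := Q.exists_logical_pair hdim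
  obtain ⟨s, hs2, hsK, hs⟩ := exists_decoding_sign Q.HX hKX (b := a) fun r hr => by
    rw [dotProduct_comm]
    exact hr a ha
  obtain ⟨s', hs2', hsK', hs'⟩ := exists_decoding_sign Q.HZ hKZ (b := b) fun r hr => by
    rw [dotProduct_comm]
    exact hr b hb
  have hanti := anticommute_of_sign (C := Q.CX) (a := a) (s := s) (s' := s')
    (fun z w hw => hs z w (Q.mem_CX_iff.1 hw)) fun y r hr => by
      -- A move `r ∈ a + dualCode CX` has zero `Z`-syndrome and `b ⬝ᵥ r = b ⬝ᵥ a = 1`, so it flips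
      -- `s'`.
      have h1 := Q.mem_CZ_iff.1 (Q.CZ.add_mem (Q.dualCode_CX_le_CZ hr) ha)
      rw [add_add_cancel_bits] at h1
      have h2 : b ⬝ᵥ r = 1 := by
        have h3 := hr b hb
        rw [add_dotProduct, hab, dotProduct_comm] at h3
        rcases bit_cases (b ⬝ᵥ r) with h | h
        · simp [h] at h3
        · exact h
      rw [hs' y r h1, h2, sgn_one, neg_one_mul]
  have h1 := uncertainty hρ (isHermitian_hadamardConj (isHermitian_diagOp s))
    (isHermitian_diagOp s') ?_ ?_ hanti ?_
  · rw [trace_mul_diagOp_re] at h1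
    linarith [sum_mul_sign_ge hρ.prob_nonneg hρ.sum_prob hs2' hsK']
  · rw [← hadamardConj_mul, diagOp_mul_diagOp, funext hs2, diagOp_one, hadamardConj_one]
  · rw [diagOp_mul_diagOp, funext hs2', diagOp_one]
  · rw [trace_mul_hadamardConj, trace_mul_diagOp_re]
    linarith [sum_mul_sign_ge hρ.hadamardConj.prob_nonneg hρ.hadamardConj.sum_prob hs2 hsK]

lemma CSSCode.sq_mul_le_of_isApproxGroundState (Q : CSSCode n mX mZ) {c₁ c₂ ε₀ ε : ℝ}
    (hc₁ : 0 < c₁) (hc₂ : 0 < c₂) (hdim : 0 < Q.dim) (hcl : Q.Clustering c₁ c₂ ε₀)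
    (hε : ε < 1 / 1000 * min (ε₀ / 2) (min (c₂ / (4 * c₁)) ((Q.dist : ℝ) / (2 * c₁ * n))))
    {a : ℕ} (C : Circuit (Fin n ⊕ Fin a))
    (hC : IsApproxGroundState Q.hamiltonian ε C.outputState) :
    c₂ ^ 2 * n ≤ 100 * 4 ^ C.depth := by
  have hn : (0 : ℝ) < n := by exact_mod_cast Q.pos_of_dim_pos hdim
  obtain ⟨hρ, hE⟩ := hC
  rw [Q.energy_eq] at hE
  have hEX : 0 ≤ ∑ y, prob (NLTS.hadamardConj C.outputState) y * violation Q.HX y :=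
    Finset.sum_nonneg fun y _ => mul_nonneg (hρ.hadamardConj.prob_nonneg y) (violation_nonneg _ _)
  have hEZ : 0 ≤ ∑ y, prob C.outputState y * violation Q.HZ y :=
    Finset.sum_nonneg fun y _ => mul_nonneg (hρ.prob_nonneg y) (violation_nonneg _ _)
  have hε' : 1000 * ε < min (ε₀ / 2) (min (c₂ / (4 * c₁)) ((Q.dist : ℝ) / (2 * c₁ * n))) := by
    linarith
  -- The syndrome cutoff `η` exceeds `1000 ε`, so each basis has expected violation at most `2 ε < η
  -- / 500`. It is positive because the energy bound forces `ε ≥ 0`.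
  obtain ⟨η, hη1, hη2⟩ := exists_between hε'
  rw [lt_min_iff, lt_min_iff, lt_div_iff₀ (by positivity), lt_div_iff₀ (by positivity),
    lt_div_iff₀ (by positivity)] at hη2
  obtain ⟨hηa, hηb, hηc⟩ := hη2
  have hη : 0 < η := by linarith
  -- The sum of two words below the cutoff `η` has syndrome weight up to `2 η m`. The three upper
  -- bounds on `η` give `2 η < ε₀`, `2 R < c₂ n` and `R < d` for `R = 2 c₁ η n`.
  obtain ⟨hclX, hclZ⟩ := hcl (2 * η) (by linarith) (by linarith)
  have hR : 0 ≤ c₁ * (2 * η) * n := by positivity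
  have hRD : 2 * (c₁ * (2 * η) * n) < c₂ * n := by nlinarith
  have hD : 0 < c₂ * n := by positivity
  have hfinish : (1 / 50 : ℝ) / 2 * (c₂ * n) ^ 2 ≤ n * 4 ^ C.depth →
      c₂ ^ 2 * n ≤ 100 * 4 ^ C.depth := fun h => by
    refine le_of_mul_le_mul_right ?_ hn
    linarith
  rcases exists_spread_or_concentrated Q.HX (dualCode Q.CZ) hρ.hadamardConj.prob_nonneg
    hρ.hadamardConj.sum_prob hη hR hclX hRD (fun y hy hy' => by
      have : (Q.dist : ℝ) ≤ cosetWeight (dualCode Q.CZ) y := by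
        exact_mod_cast Q.dist_le_cosetWeight_X (Q.mem_CX_iff.2 hy) hy'
      linarith) (by linarith) with ⟨S, T, hS, hT, hST⟩ | ⟨KX, hKX, hKX'⟩
  · exact hfinish (sq_dist_le_of_spread_prob_hadamardConj C hD (by norm_num) hST hS hT)
  rcases exists_spread_or_concentrated Q.HZ (dualCode Q.CX) hρ.prob_nonneg
    hρ.sum_prob hη hR hclZ hRD (fun y hy hy' => by
      have : (Q.dist : ℝ) ≤ cosetWeight (dualCode Q.CX) y := by
        exact_mod_cast Q.dist_le_cosetWeight_Z (Q.mem_CZ_iff.2 hy) hy'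
      linarith) (by linarith) with ⟨S, T, hS, hT, hST⟩ | ⟨KZ, hKZ, hKZ'⟩
  · exact hfinish (sq_dist_le_of_spread_prob C hD (by norm_num) hST hS hT)
  · exact absurd hKZ (not_le.2 (Q.not_both_concentrated hdim hρ hKX' hKZ' hKX))

lemma le_depth_of_sq_mul_le {c : ℝ} {N t : ℕ} (hc : 0 < c) (hN : 0 < N)
    (h : c ^ 2 * N ≤ 100 * 4 ^ t) :
    1 / 3 * Real.logb 2 (c ^ 2 * N / (400 * Real.logb 2 (1 / 0.02))) + 1 ≤ t := by
  -- Since `2⁵ ≤ 50`, the argument of the outer logarithm is at most `100 * 4 ^ t / 2000 ≤ 8 ^ t /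
  -- 8`; the divisor `8` accounts for the `+ 1`.
  have hlog : (5 : ℝ) ≤ Real.logb 2 (1 / 0.02) := by
    rw [Real.le_logb_iff_rpow_le (by norm_num) (by norm_num)]
    norm_num
  have hN' : (0 : ℝ) < N := by exact_mod_cast hN
  have hx : c ^ 2 * N / (400 * Real.logb 2 (1 / 0.02)) ≤ (2 : ℝ) ^ (3 * ((t : ℝ) - 1)) := by
    have hpow : (2 : ℝ) ^ (3 * ((t : ℝ) - 1)) = 8 ^ t / 8 := by
      rw [mul_sub, mul_one, Real.rpow_sub (by norm_num), Real.rpow_mul (by norm_num),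
        Real.rpow_natCast]
      norm_num
    have h48 : (4 : ℝ) ^ t ≤ 8 ^ t := pow_le_pow_left₀ (by norm_num) (by norm_num) t
    have h8 : (0 : ℝ) < 8 ^ t := by positivity
    rw [hpow, div_le_iff₀ (by linarith)]
    nlinarith
  have := (Real.logb_le_iff_le_rpow (by norm_num) (div_pos (by positivity) (by linarith))).2 hx
  linarith

/-! ## Small-set expansion -/

/-- Elements of `N` have zero syndrome, so expansion may be applied to the lightest word in the
coset of `y`, which is short enough as soon as the coset weight is at most `c₁ n`. -/
lemma clustering_of_expansion {m : ℕ} (H : Matrix (Fin m) (Fin n) (ZMod 2))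
    {N : Submodule (ZMod 2) (Fin n → ZMod 2)} (hN : ∀ r ∈ N, H.mulVec r = 0) {c₁ c₂ ε : ℝ}
    (hn : 0 < n) (hc₂ : 0 < c₂) (hε : 0 ≤ ε)
    (h : ∀ y : Fin n → ZMod 2, (hammingNorm y : ℝ) ≤ c₁ * n →
      c₂ * ((cosetWeight N y : ℝ) / n) ≤ (hammingNorm (H.mulVec y) : ℝ) / m)
    {y : Fin n → ZMod 2} (hy : (hammingNorm (H.mulVec y) : ℝ) ≤ ε * m) :
    (cosetWeight N y : ℝ) ≤ 1 / c₂ * ε * n ∨ c₁ * n < (cosetWeight N y : ℝ) := by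
  by_contra! hcon
  obtain ⟨h1, h2⟩ := hcon
  have hn' : (0 : ℝ) < n := by exact_mod_cast hn
  obtain ⟨r, hr, hyr⟩ := exists_hammingNorm_eq_cosetWeight N y
  have h3 := h (y + r) (by rwa [hyr])
  have hle : cosetWeight N y ≤ cosetWeight N (y + r) := by
    obtain ⟨r', hr', hyr'⟩ := exists_hammingNorm_eq_cosetWeight N (y + r)
    rw [← hyr', add_assoc]
    exact cosetWeight_le y (N.add_mem hr hr')
  rw [Matrix.mulVec_add, hN r hr, add_zero] at h3
  have h4 : (hammingNorm (H.mulVec y) : ℝ) / m ≤ ε := div_le_of_le_mul₀ (by positivity) hε hy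
  have h5 : c₂ * ((cosetWeight N y : ℝ) / n) ≤ ε := by
    refine le_trans (mul_le_mul_of_nonneg_left ?_ hc₂.le) (h3.trans h4)
    gcongr
  have h6 : 1 / c₂ * ε * n < (cosetWeight N y : ℝ) := h1
  have h7 : ε < c₂ * ((cosetWeight N y : ℝ) / n) := by
    calc ε = c₂ * ((1 / c₂ * ε * n) / n) := by field_simp
      _ < _ := by gcongr
  linarith

variable (Q : CSSCode n mX mZ)

lemma CSSCode.clustering_of_smallSetExpansion {c₁ c₂ ε₀ : ℝ} (hc₂ : 0 < c₂)
    (hdim : 0 < Q.dim) (hB : Q.SmallSetBoundaryExpansion c₁ c₂)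
    (hC : Q.SmallSetCoboundaryExpansion c₁ c₂) : Q.Clustering (1 / c₂) c₁ ε₀ := by
  intro ε hε _
  have hn := Q.pos_of_dim_pos hdim
  exact ⟨fun y hy => (clustering_of_expansion Q.HX
      (fun r hr => Q.mem_CX_iff.1 (Q.dualCode_CZ_le_CX hr)) hn hc₂ hε.le hC hy).imp_right le_of_lt,
    fun y hy => (clustering_of_expansion Q.HZ
      (fun r hr => Q.mem_CZ_iff.1 (Q.dualCode_CX_le_CZ hr)) hn hc₂ hε.le hB hy).imp_right le_of_lt⟩

lemma CSSCode.lt_dist_of_smallSetExpansion {c₁ c₂ : ℝ} (hc₂ : 0 < c₂)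
    (hdim : 0 < Q.dim) (hB : Q.SmallSetBoundaryExpansion c₁ c₂)
    (hC : Q.SmallSetCoboundaryExpansion c₁ c₂) : c₁ * n < Q.dist := by
  have hn := Q.pos_of_dim_pos hdim
  have key : ∀ {m : ℕ} (H : Matrix (Fin m) (Fin n) (ZMod 2))
      (N : Submodule (ZMod 2) (Fin n → ZMod 2)), (∀ r ∈ N, H.mulVec r = 0) →
      (∀ y : Fin n → ZMod 2, (hammingNorm y : ℝ) ≤ c₁ * n →
        c₂ * ((cosetWeight N y : ℝ) / n) ≤ (hammingNorm (H.mulVec y) : ℝ) / m) →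
      ∀ y, H.mulVec y = 0 → y ∉ N → c₁ * n < hammingNorm y := by
    intro m H N hN h y hy hyN
    -- At zero syndrome the first alternative is coset weight zero, that is, membership in `N`.
    rcases clustering_of_expansion (ε := 0) H hN hn hc₂ le_rfl h (y := y) (by simp [hy]) with h1 | h1
    · refine absurd (mem_of_cosetWeight_eq_zero ?_) hyN
      rw [mul_zero, zero_mul] at h1
      exact_mod_cast le_antisymm h1 (Nat.cast_nonneg _)
    · refine h1.trans_le ?_
      exact_mod_cast cosetWeight_le_hammingNorm N y
  obtain ⟨a, ha, b, hb, hab⟩ := Q.exists_logical_pair hdim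
  -- An infimum over the empty set would be `0`; the logical operator `a` rules this out.
  have hne : {w | ∃ y : Fin n → ZMod 2,
      ((y ∈ Q.CZ ∧ y ∉ dualCode Q.CX) ∨ (y ∈ Q.CX ∧ y ∉ dualCode Q.CZ)) ∧
        hammingNorm y = w}.Nonempty :=
    ⟨_, a, Or.inl ⟨ha, fun h => by simp [h b hb] at hab⟩, rfl⟩
  obtain ⟨y, hy, hyd⟩ := Nat.sInf_mem hne
  rw [CSSCode.dist, ← hyd]
  rcases hy with ⟨hy, hy'⟩ | ⟨hy, hy'⟩
  · exact key Q.HZ _ (fun r hr => Q.mem_CZ_iff.1 (Q.dualCode_CX_le_CZ hr)) hB y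
      (Q.mem_CZ_iff.1 hy) hy'
  · exact key Q.HX _ (fun r hr => Q.mem_CX_iff.1 (Q.dualCode_CZ_le_CX hr)) hC y
      (Q.mem_CX_iff.1 hy) hy'

/-- The choice `ε₀ = 1` accounts for the `1/2` in the minimum, `c₁ c₂ / 4` is the clustering
threshold, and the distance threshold exceeds it. The prefactor `1/2000` is half of `1/1000`, giving
the strict inequality. -/
lemma CSSCode.sq_mul_le_of_smallSetExpansion {c₁ c₂ : ℝ} (hc₁ : 0 < c₁) (hc₂ : 0 < c₂)
    (hdim : 0 < Q.dim) (hB : Q.SmallSetBoundaryExpansion c₁ c₂)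
    (hC : Q.SmallSetCoboundaryExpansion c₁ c₂) {a : ℕ} (C : Circuit (Fin n ⊕ Fin a))
    (hρ : IsApproxGroundState Q.hamiltonian (1 / 2000 * min (1 / 2) (c₁ * c₂ / 4))
      C.outputState) :
    c₁ ^ 2 * n ≤ 100 * 4 ^ C.depth := by
  have hn : (0 : ℝ) < n := by exact_mod_cast Q.pos_of_dim_pos hdim
  refine Q.sq_mul_le_of_isApproxGroundState (ε₀ := 1) (one_div_pos.2 hc₂) hc₁ hdim
    (Q.clustering_of_smallSetExpansion hc₂ hdim hB hC) ?_ C hρ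
  have hpos : 0 < min (1 / 2) (c₁ * c₂ / 4) := lt_min (by norm_num) (by positivity)
  have hle : min (1 / 2) (c₁ * c₂ / 4) ≤
      min (1 / 2) (min (c₁ / (4 * (1 / c₂))) ((Q.dist : ℝ) / (2 * (1 / c₂) * n))) := by
    refine min_le_min_left _ (le_min (le_of_eq (by field_simp)) ?_)
    rw [le_div_iff₀ (by positivity)]
    have := Q.lt_dist_of_smallSetExpansion hc₂ hdim hB hC
    calc c₁ * c₂ / 4 * (2 * (1 / c₂) * n) = c₁ * n / 2 := by field_simp; ring
      _ ≤ Q.dist := by nlinarith [mul_pos hc₁ hn]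
  linarith

end Codes

theorem isNLTS_of_smallSetExpansion {n mX mZ : ℕ → ℕ} (Q : (j : ℕ) → CSSCode (n j) (mX j) (mZ j))
    {ℓ : ℕ} {c₁ c₂ : ℝ} (hc₁ : 0 < c₁) (hc₂ : 0 < c₂) (hn : Tendsto n atTop atTop)
    (hℓ : ∀ j, (Q j).HasLocality ℓ) (hdim : ∀ j, 0 < (Q j).dim)
    (hB : ∀ j, (Q j).SmallSetBoundaryExpansion c₁ c₂)
    (hC : ∀ j, (Q j).SmallSetCoboundaryExpansion c₁ c₂) :
    IsNLTS n fun j => (Q j).hamiltonian := by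
  refine ⟨⟨ℓ, fun j => (Q j).isLocalHamiltonian_hamiltonian (hℓ j)⟩,
    fun j => ⟨(Q j).hamiltonian_posSemidef, (Q j).one_sub_hamiltonian_posSemidef⟩,
    1 / 2000 * min (1 / 2) (c₁ * c₂ / 4),
    mul_pos (by norm_num) (lt_min (by norm_num) (by positivity)), ?_⟩
  rw [ENat.tendsto_nhds_top_iff_natCast_lt]
  intro K
  have hlarge : Tendsto (fun j => c₁ ^ 2 * (n j : ℝ)) atTop atTop :=
    (tendsto_natCast_atTop_atTop.comp hn).const_mul_atTop (by positivity)
  filter_upwards [hlarge.eventually_gt_atTop (100 * 4 ^ K)] with j hj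
  -- The minimum depth is an infimum in `ℕ∞`, so it suffices to bound every admissible circuit; if
  -- there is none, the value is `⊤`.
  have hle : ((K + 1 : ℕ) : ℕ∞) ≤
      minDepth (Q j).hamiltonian (1 / 2000 * min (1 / 2) (c₁ * c₂ / 4)) := by
    refine le_sInf ?_
    rintro t ⟨a, C, hρ, rfl⟩
    have h := (Q j).sq_mul_le_of_smallSetExpansion hc₁ hc₂ (hdim j) (hB j) (hC j) C hρ
    have hlt : (4 : ℝ) ^ K < 4 ^ C.depth := by linarith
    exact_mod_cast Nat.succ_le_of_lt ((pow_lt_pow_iff_right₀ (by norm_num)).1 hlt)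
  exact lt_of_lt_of_le (by exact_mod_cast Nat.lt_succ_self K) hle

end NLTS

end

theorem mainTheorem2 :
    -- the depth lower bound
    (∀ (n mX mZ : ℕ) (Q : NLTS.CSSCode n mX mZ) (c₁ c₂ ε₀ ε : ℝ),
      0 < c₁ → 0 < c₂ → 0 < ε₀ →
      0 < Q.dim →
      Q.Clustering c₁ c₂ ε₀ →
      ε < 1 / 1000 * min (ε₀ / 2) (min (c₂ / (4 * c₁)) ((Q.dist : ℝ) / (2 * c₁ * n))) →
      ∀ ρ : NLTS.Op (Fin n), NLTS.IsApproxGroundState Q.hamiltonian ε ρ →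
        ¬ ∃ (a : ℕ) (C : NLTS.Circuit (Fin n ⊕ Fin a)),
          NLTS.Circuit.outputState C = ρ ∧
          (NLTS.Circuit.depth C : ℝ) <
            1 / 3 * Real.logb 2 (c₂ ^ 2 * n / (400 * Real.logb 2 (1 / 0.02))) + 1) ∧
    -- low-rate codes with small-set expansion give NLTS Hamiltonians
    (∀ (n mX mZ : ℕ → ℕ) (Q : (j : ℕ) → NLTS.CSSCode (n j) (mX j) (mZ j))
      (ℓ : ℕ) (c₁ c₂ : ℝ),
      0 < c₁ → 0 < c₂ →
      Filter.Tendsto n Filter.atTop Filter.atTop →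
      (∀ j, (Q j).HasLocality ℓ) →
      (∀ j, 0 < (Q j).dim) →
      (∀ j, (Q j).SmallSetBoundaryExpansion c₁ c₂) →
      (∀ j, (Q j).SmallSetCoboundaryExpansion c₁ c₂) →
      NLTS.IsNLTS n (fun j => (Q j).hamiltonian)) := by 
  refine ⟨?_, ?_⟩
  · rintro n mX mZ Q c₁ c₂ ε₀ ε hc₁ hc₂ - hdim hcl hε ρ hρ ⟨a, C, rfl, hdepth⟩
    exact hdepth.not_ge (NLTS.le_depth_of_sq_mul_le hc₂ (Q.pos_of_dim_pos hdim)
      (Q.sq_mul_le_of_isApproxGroundState hc₁ hc₂ hdim hcl hε C hρ))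
  · intro n mX mZ Q ℓ c₁ c₂ hc₁ hc₂ hn hℓ hdim hB hC
    exact NLTS.isNLTS_of_smallSetExpansion Q hc₁ hc₂ hn hℓ hdim hB hC
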